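/- Let $d\ge 1$ and let $\mathcal X=[0,1]^d$ carry the Euclidean distance; $\rho(x,A)=\inf_{y\in A}\|x-y\|$ (with $\inf\emptyset=+\infty$), $B(x,\varepsilon)=\{y\in\mathcal X:\|x-y\|\le\varepsilon\}$ for $x\in\mathcal X$, and boundaries $\partial$ are taken relative to $\mathcal X$. For a function $f$ on $\mathcal X$ put $G^*_\gamma=\{x\in\mathcal X: f(x)\ge\gamma\}$, and for $G\subseteq\mathcal X$ put $\mathcal I_\varepsilon(G)=\bigcup_{x:\,B(x,\varepsilon)\subseteq G}B(x,\varepsilon)$. For nonempty $G_1,G_2\subseteq\mathcal X$ let $$d_\infty(G_1,G_2)=\max\Big\{\sup_{x\in G_2}\rho(x,G_1),\ \sup_{x\in G_1}\rho(x,G_2)\Big\},$$ and if $G_1$ or $G_2$ is empty let $d_\infty(G_1,G_2)$ be the diameter of $\mathcal X$. For positive constants $\alpha,\gamma,f_{\max},C_1,C_2,C_3,\varepsilon_o,\delta_1,\delta_2$ consider, for a probability density $f:\mathcal X\to[0,f_{\max}]$, the conditions [A1] for all $x\in\mathcal X$ with $|f(x)-\gamma|\le\delta_1$: $|f(x)-\gamma|\ge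 C_1\,\rho(x,\partial G^*_\gamma)^\alpha$; [A2] there is $x_0\in\partial G^*_\gamma$ such that $|f(x)-\gamma|\le C_2\,\rho(x,\partial G^*_\gamma)^\alpha$ for all $x\in B(x_0,\delta_2)$; [B] for all $0<\varepsilon\le\varepsilon_o$: $\mathcal I_\varepsilon(G^*_\gamma)\ne\emptyset$ and $\rho(x,\mathcal I_\varepsilon(G^*_\gamma))\le C_3\varepsilon$ for all $x\in\partial G^*_\gamma$. Let $\mathcal F^*_1(\alpha)$ be the class of such densities satisfying [A1] and [B], and $\mathcal F^*_2(\alpha)$ the class of those satisfying [A1], [A2] and [B]. Proposition 1. Let $d\ge1$, $\alpha>0$, $\gamma>0$, $f_{\max}>\max(\gamma,1)$, $0<C_1\le C_2$, $C_3>0$ and $\delta_1>0$. Then for all sufficiently small $\varepsilon_o>0$ and $\delta_2>0$ (how small may depend on the constants just listed) there is a constant $c>0$ such that, for all large enough $n$, $$\inf_{G_n}\ \sup_{f\in\mathcal F^*_1(\alpha)}\mathbb E\,[d_\infty(G_n,G^*_\gamma)]\ \ge\ \inf_{G_n}\ \sup_{f\in\mathcal F^*_2(\alpha)}\mathbb E\,[d_\infty(G_n,G^*_\gamma)]\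 \ge\ c\Big(\frac{n}{\log n}\Big)^{-1/(d+2\alpha)},$$ where the infima are over all (measurable) set estimators $G_n$ based on $n$ independent observations from $f$, and $\mathbb E$ is the expectation with respect to these observations. -/

import Mathlib

open MeasureTheory Filter
open scoped ENNReal

noncomputable section

/-- The domain `𝒳 = [0,1]^d` with the Euclidean distance. Being a subtype, it carries the metric
induced from `ℝ^d`; closed balls and topological boundaries in it are relative to `𝒳`. -/
abbrev UnitCube (d : ℕ) : Type :=
  {x : EuclideanSpace ℝ (Fin d) // ∀ i, x i ∈ Set.Icc (0 : ℝ) 1}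

/-- Lebesgue measure on `[0,1]^d`. -/
def cubeVolume (d : ℕ) : Measure (UnitCube d) :=
  Measure.comap Subtype.val (volume : Measure (EuclideanSpace ℝ (Fin d)))

/-- `f` is a probability density on `[0,1]^d` with values in `[0, fmax]`. -/
structure IsBoundedDensity {d : ℕ} (fmax : ℝ) (f : UnitCube d → ℝ) : Prop where
  measurable : Measurable f
  nonneg : ∀ x, 0 ≤ f x
  le_max : ∀ x, f x ≤ fmax
  lintegral_eq_one : ∫⁻ x, ENNReal.ofReal (f x) ∂(cubeVolume d) = 1

/-- The `γ`-level set `{x ∈ 𝒳 : f x ≥ γ}`. -/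
def levelSet {d : ℕ} (f : UnitCube d → ℝ) (γ : ℝ) : Set (UnitCube d) :=
  {x | γ ≤ f x}

/-- The inner `ε`-cover of `G`: the union of all closed `ε`-balls of `𝒳` contained in `G`. -/
def innerCover {d : ℕ} (ε : ℝ) (G : Set (UnitCube d)) : Set (UnitCube d) :=
  ⋃ x ∈ {x : UnitCube d | Metric.closedBall x ε ⊆ G}, Metric.closedBall x ε

/-- Lower density regularity around the level `γ`. The distance to an empty boundary is `+∞`,
so the lower bound fails at `x` when the boundary is empty. -/
def LowerRegular {d : ℕ} (α γ C₁ δ₁ : ℝ) (f : UnitCube d → ℝ) : Prop :=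
  ∀ x, |f x - γ| ≤ δ₁ → (frontier (levelSet f γ)).Nonempty ∧
    C₁ * Metric.infDist x (frontier (levelSet f γ)) ^ α ≤ |f x - γ|

/-- Upper density regularity in a `δ₂`-ball around some point of the boundary. -/
def UpperRegular {d : ℕ} (α γ C₂ δ₂ : ℝ) (f : UnitCube d → ℝ) : Prop :=
  ∃ x₀ ∈ frontier (levelSet f γ), ∀ x ∈ Metric.closedBall x₀ δ₂,
    |f x - γ| ≤ C₂ * Metric.infDist x (frontier (levelSet f γ)) ^ α

/-- Level set regularity. -/
def LevelSetRegular {d : ℕ} (γ C₃ ε₀ : ℝ) (f : UnitCube d → ℝ) : Prop :=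
  ∀ ε, 0 < ε → ε ≤ ε₀ → (innerCover ε (levelSet f γ)).Nonempty ∧
    ∀ x ∈ frontier (levelSet f γ), Metric.infDist x (innerCover ε (levelSet f γ)) ≤ C₃ * ε

/-- The class `𝓕₁*(α)`. -/
def classF1 (d : ℕ) (α γ fmax C₁ C₃ ε₀ δ₁ : ℝ) : Set (UnitCube d → ℝ) :=
  {f | IsBoundedDensity fmax f ∧ LowerRegular α γ C₁ δ₁ f ∧ LevelSetRegular γ C₃ ε₀ f}

/-- The class `𝓕₂*(α)`. -/
def classF2 (d : ℕ) (α γ fmax C₁ C₂ C₃ ε₀ δ₁ δ₂ : ℝ) : Set (UnitCube d → ℝ) :=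
  {f | IsBoundedDensity fmax f ∧ LowerRegular α γ C₁ δ₁ f ∧ UpperRegular α γ C₂ δ₂ f ∧
    LevelSetRegular γ C₃ ε₀ f}

open Classical in
/-- The Hausdorff error `d_∞`; if one of the sets is empty it is the largest distance between
two points of the domain. -/
def hausdorffError {d : ℕ} (A B : Set (UnitCube d)) : ℝ≥0∞ :=
  if A.Nonempty ∧ B.Nonempty then Metric.hausdorffEDist A B
  else Metric.ediam (Set.univ : Set (UnitCube d))

/-- The law of `n` independent observations from the density `f`. -/
def sampleLaw {d : ℕ} (n : ℕ) (f : UnitCube d → ℝ) : Measure (Fin n → UnitCube d) :=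
  Measure.pi fun _ => (cubeVolume d).withDensity fun x => ENNReal.ofReal (f x)

/-- A set estimator based on `n` observations: a set-valued function of the sample which is
measurable in the sense that its Hausdorff error with respect to any set is a random variable. -/
def IsSetEstimator {d n : ℕ} (Ghat : (Fin n → UnitCube d) → Set (UnitCube d)) : Prop :=
  ∀ B : Set (UnitCube d), Measurable fun X => hausdorffError (Ghat X) B

/-- The minimax expected Hausdorff error over the class `𝓕`, for `n` observations. -/
def minimaxRisk {d : ℕ} (n : ℕ) (γ : ℝ) (𝓕 : Set (UnitCube d → ℝ)) : ℝ≥0∞ :=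
  ⨅ Ghat ∈ {G : (Fin n → UnitCube d) → Set (UnitCube d) | IsSetEstimator G},
    ⨆ f ∈ 𝓕, ∫⁻ X, hausdorffError (Ghat X) (levelSet f γ) ∂(sampleLaw n f)

end

/-! The proof compares one density `f₀` with `M` perturbations `f k`, each supported near a
different place and moving the level set by a Hausdorff distance of order `r`. If the chi-square
divergence of one perturbation is `V` and `(1 + V) ^ n ≤ M / 4`, then `f₀` cannot be told from the
uniform mixture of the `f k`, and the risk is at least of order `r`. Here `V` is of order `r ^ (d +
2 * α)`: a change of size `r ^ α` on a set of volume at most of order `r ^ d`. With `M` a power of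
`1 / r` the condition reads `n * V ≲ log (1 / r)`, which gives `r` of order `(log n / n) ^ (1 / (d +
2 * α))`.

For `d = 1` a smooth boundary has no room for many bumps, so the multiplicity is put into the level
set itself. All densities are based on a profile `Layout.base` of a single coordinate, and a slab of
the level set is cut along null slices over a finite set `K` of `2 ^ m` points, the `m`-th stage of
a Cantor construction with ratio `q`, at separation of order `q ^ m`. Each slice is part of the
boundary, and digging a thin hole of radius `r` around one point of it moves the level set by a
fixed multiple of `r`. Mass removed from the hole is put on a translated copy beside it, where the
density already exceeds `γ`.

The regularity conditions are kept as follows. [B] holds with arbitrarily small `C₃` because `K` is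
porous with a small constant `lam` (`exists_porous_finset`) and the holes are flat, of slope `lam /
24`; see `Layout.IsBump.levelSetRegular`. [A1] holds because the density moves off `γ` exactly like
`C₁ * dist ^ α` where needed, while elsewhere it is far from `γ` and a fine comb of slabs keeps the
boundary within `1 / N` (`Layout.IsBump.lowerRegular`). [A2] is met at the left end of the cut slab,
away from `K`, where the profile is exactly a power (`Layout.IsBump.upperRegular`).

The statistical part is `sum_integral_pi_withDensity_le` and `ofReal_le_minimaxRisk`; `exists_depth`
chooses `m` as a function of `n`. -/

/-! ### Porous Cantor-type sets on the line. -/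

/-- Near every point of `A` and at every scale `ε` there is an interval of radius `ε` whose interior
misses `A` and whose centre is at distance at most `(1 + lam) * ε` from the point. -/
def IsPorous (lam : ℝ) (A : Set ℝ) : Prop :=
  ∀ a ∈ A, ∀ ε, 0 < ε → ∃ y, |y - a| ≤ (1 + lam) * ε ∧ ∀ a' ∈ A, ε ≤ |y - a'|

theorem isPorous_singleton_zero {lam : ℝ} (hlam : 0 < lam) : IsPorous lam {0} := by
  rintro a rfl ε hε
  refine ⟨ε, ?_, ?_⟩
  · rw [sub_zero, abs_of_pos hε]; nlinarith
  · rintro a' rfl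
    rw [sub_zero, abs_of_pos hε]

/-- Small scales are inherited from the copy containing the point, since the other copy is too far
away to interfere. At scales above `1 / 6` one leaves the whole set: each copy has width at most `2
* q`, and `2 * q ≤ lam / 6 < lam * ε` is the admissible excess, whence `q ≤ lam / 12`. -/
theorem IsPorous.union_scaled {lam q : ℝ} {A : Set ℝ} (hlam : 0 < lam) (hlam1 : lam ≤ 1)
    (hq : 0 < q) (hq1 : q ≤ lam / 12) (hA : IsPorous lam A) (hA2 : A ⊆ Set.Icc 0 2) :
    IsPorous lam ((fun x => q * x) '' A ∪ (fun x => 1 + q * x) '' A) := by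
  have hq8 : q ≤ 1 / 12 := by linarith
  rintro _ (⟨a, ha, rfl⟩ | ⟨a, ha, rfl⟩) ε hε
  · have ha2 := hA2 ha
    obtain hs | hs := le_or_gt ε (1 / 6)
    · obtain ⟨y, hy, hy'⟩ := hA a ha (ε / q) (by positivity)
      have hyd : |q * y - q * a| ≤ (1 + lam) * ε := by
        rw [← mul_sub, abs_mul, abs_of_pos hq]
        calc q * |y - a| ≤ q * ((1 + lam) * (ε / q)) := by gcongr
          _ = (1 + lam) * ε := by field_simp
      refine ⟨q * y, hyd, ?_⟩
      rintro _ (⟨b, hb, rfl⟩ | ⟨b, hb, rfl⟩)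
      · have := hy' b hb
        simp only
        rw [← mul_sub, abs_mul, abs_of_pos hq]
        calc ε = q * (ε / q) := by field_simp
          _ ≤ _ := by gcongr
      · have hb2 := hA2 hb
        have h1 := (abs_le.1 hyd).2
        have h2 : 0 ≤ q * b := mul_nonneg hq.le hb2.1
        have h3 : q * a ≤ q * 2 := by gcongr; exact ha2.2
        rw [abs_sub_comm]
        refine le_trans ?_ (le_abs_self _)
        simp only
        nlinarith
    -- From the left copy the escape is to the left of `0`; from the right copy it is to the right
    -- of `1 + 2 * q`.
    · refine ⟨-ε, ?_, ?_⟩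
      · have h3 : q * a ≤ q * 2 := by gcongr; exact ha2.2
        have h2 : 0 ≤ q * a := mul_nonneg hq.le ha2.1
        rw [abs_le]; constructor <;> nlinarith
      · rintro _ (⟨b, hb, rfl⟩ | ⟨b, hb, rfl⟩) <;>
        · have h2 : 0 ≤ q * b := mul_nonneg hq.le (hA2 hb).1
          rw [abs_sub_comm]
          refine le_trans ?_ (le_abs_self _)
          simp only
          linarith
  · have ha2 := hA2 ha
    obtain hs | hs := le_or_gt ε (1 / 6)
    · obtain ⟨y, hy, hy'⟩ := hA a ha (ε / q) (by positivity)
      have hyd : |(1 + q * y) - (1 + q * a)| ≤ (1 + lam) * ε := by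
        rw [add_sub_add_left_eq_sub, ← mul_sub, abs_mul, abs_of_pos hq]
        calc q * |y - a| ≤ q * ((1 + lam) * (ε / q)) := by gcongr
          _ = (1 + lam) * ε := by field_simp
      refine ⟨1 + q * y, hyd, ?_⟩
      rintro _ (⟨b, hb, rfl⟩ | ⟨b, hb, rfl⟩)
      · have hb2 := hA2 hb
        have h1 := (abs_le.1 hyd).1
        have h2 : 0 ≤ q * a := mul_nonneg hq.le ha2.1
        have h3 : q * b ≤ q * 2 := by gcongr; exact hb2.2
        refine le_trans ?_ (le_abs_self _)
        simp only
        nlinarith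
      · have := hy' b hb
        simp only
        rw [add_sub_add_left_eq_sub, ← mul_sub, abs_mul, abs_of_pos hq]
        calc ε = q * (ε / q) := by field_simp
          _ ≤ _ := by gcongr
    · refine ⟨1 + 2 * q + ε, ?_, ?_⟩
      · have h3 : q * a ≤ q * 2 := by gcongr; exact ha2.2
        have h2 : 0 ≤ q * a := mul_nonneg hq.le ha2.1
        rw [abs_le]; constructor <;> nlinarith
      · rintro _ (⟨b, hb, rfl⟩ | ⟨b, hb, rfl⟩) <;>
        · have h2 : q * b ≤ q * 2 := by gcongr; exact (hA2 hb).2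
          refine le_trans ?_ (le_abs_self _)
          simp only
          linarith

theorem IsPorous.affine {lam l : ℝ} {A : Set ℝ} (hA : IsPorous lam A) (hl : 0 < l) (s : ℝ) :
    IsPorous lam ((fun x => s + l * x) '' A) := by
  rintro _ ⟨a, ha, rfl⟩ ε hε
  obtain ⟨y, hy, hy'⟩ := hA a ha (ε / l) (by positivity)
  refine ⟨s + l * y, ?_, ?_⟩
  · simp only
    rw [add_sub_add_left_eq_sub, ← mul_sub, abs_mul, abs_of_pos hl]
    calc l * |y - a| ≤ l * ((1 + lam) * (ε / l)) := by gcongr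
      _ = (1 + lam) * ε := by field_simp
  · rintro _ ⟨b, hb, rfl⟩
    have := hy' b hb
    simp only
    rw [add_sub_add_left_eq_sub, ← mul_sub, abs_mul, abs_of_pos hl]
    calc ε = l * (ε / l) := by field_simp
      _ ≤ _ := by gcongr

-- Iterating the two-copy construction from a point doubles the cardinality and multiplies the
-- separation by `q`, with the same porosity constant throughout. So the logarithm of the
-- cardinality is proportional to that of the inverse separation, uniformly in `m`.
open Classical in
theorem exists_porous_finset {lam q : ℝ} (hlam : 0 < lam) (hlam1 : lam ≤ 1) (hq : 0 < q)
    (hq1 : q ≤ lam / 12) (m : ℕ) :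
    ∃ E : Finset ℝ, E.card = 2 ^ m ∧ (E : Set ℝ) ⊆ Set.Icc 0 2 ∧ IsPorous lam (E : Set ℝ) ∧
      ∀ a ∈ E, ∀ b ∈ E, a ≠ b → q ^ m ≤ |a - b| := by
  have hq8 : q ≤ 1 / 12 := by linarith
  induction m with
  | zero =>
    refine ⟨{0}, by simp, by simp, by simpa using isPorous_singleton_zero hlam, ?_⟩
    simp
  | succ m ih =>
    obtain ⟨E, hcard, hsub, hpor, hsep⟩ := ih
    have hcross : ∀ a ∈ E, ∀ b ∈ E, q ^ (m + 1) ≤ (1 + q * b) - q * a := by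
      intro a ha b hb
      have ha2 := hsub ha
      have hb2 := hsub hb
      have h1 : q ^ (m + 1) ≤ q ^ 1 := pow_le_pow_of_le_one hq.le (by linarith) (by lia)
      have h2 : 0 ≤ q * b := mul_nonneg hq.le hb2.1
      have h3 : q * a ≤ q * 2 := by gcongr; exact ha2.2
      rw [pow_one] at h1
      linarith
    have hpos : 0 < q ^ (m + 1) := by positivity
    refine ⟨E.image (fun x => q * x) ∪ E.image (fun x => 1 + q * x), ?_, ?_, ?_, ?_⟩
    · rw [Finset.card_union_of_disjoint, Finset.card_image_of_injective,
        Finset.card_image_of_injective, hcard]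
      · ring
      · intro a b h
        simpa [hq.ne'] using h
      · intro a b h
        simpa [hq.ne'] using h
      · rw [Finset.disjoint_left]
        rintro _ h1 h2
        obtain ⟨a, ha, rfl⟩ := Finset.mem_image.1 h1
        obtain ⟨b, hb, hab⟩ := Finset.mem_image.1 h2
        have := hcross a ha b hb
        linarith
    · intro x hx
      simp only [Finset.coe_union, Finset.coe_image] at hx
      rcases hx with (⟨a, ha, rfl⟩ | ⟨a, ha, rfl⟩) <;>
      · have ha2 := hsub ha
        have h2 : 0 ≤ q * a := mul_nonneg hq.le ha2.1
        have h3 : q * a ≤ q * 2 := by gcongr; exact ha2.2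
        constructor <;> simp only <;> linarith
    · simpa using hpor.union_scaled hlam hlam1 hq hq1 hsub
    · intro a ha b hb hab
      simp only [Finset.mem_union, Finset.mem_image] at ha hb
      have key : ∀ a ∈ E, ∀ b ∈ E, a ≠ b → q ^ (m + 1) ≤ |q * a - q * b| := by
        intro a ha b hb h
        rw [← mul_sub, abs_mul, abs_of_pos hq, pow_succ']
        gcongr
        exact hsep a ha b hb h
      rcases ha with (⟨a, ha, rfl⟩ | ⟨a, ha, rfl⟩) <;> rcases hb with (⟨b, hb, rfl⟩ | ⟨b, hb, rfl⟩)
      · exact key a ha b hb (by rintro rfl; exact hab rfl)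
      · rw [abs_sub_comm]
        exact (hcross a ha b hb).trans (le_abs_self _)
      · exact (hcross b hb a ha).trans (le_abs_self _)
      · rw [add_sub_add_left_eq_sub]
        exact key a ha b hb (by rintro rfl; exact hab rfl)

/-! ### Boundaries, inner covers and Hausdorff errors in the cube. -/

section Cube

variable {d : ℕ}

theorem abs_coord_sub_le_dist (i : Fin d) (x y : UnitCube d) : |x.1 i - y.1 i| ≤ dist x y := by
  rw [Subtype.dist_eq, dist_eq_norm, ← Real.norm_eq_abs]
  exact PiLp.norm_apply_le (x.1 - y.1) i

/-- The point `x` with its `i`-th coordinate replaced by `t`. -/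
def moveCoord (i : Fin d) (x : UnitCube d) (t : ℝ) (ht : t ∈ Set.Icc (0 : ℝ) 1) : UnitCube d :=
  ⟨WithLp.toLp 2 (Function.update x.1 i t), fun j => by
    by_cases h : j = i
    · subst h; simpa using ht
    · simpa [h] using x.2 j⟩

@[simp] theorem moveCoord_apply_self (i : Fin d) (x : UnitCube d) (t : ℝ)
    (ht : t ∈ Set.Icc (0 : ℝ) 1) : (moveCoord i x t ht).1 i = t := by
  simp [moveCoord]

theorem dist_moveCoord_moveCoord (i : Fin d) (x : UnitCube d) (s t : ℝ)
    (hs : s ∈ Set.Icc (0 : ℝ) 1) (ht : t ∈ Set.Icc (0 : ℝ) 1) :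
    dist (moveCoord i x s hs) (moveCoord i x t ht) = |s - t| := by
  rw [Subtype.dist_eq, EuclideanSpace.dist_eq, Finset.sum_eq_single i]
  · simp [moveCoord, Real.dist_eq, Real.sqrt_sq_eq_abs]
  · intro j _ hj
    simp [moveCoord, hj]
  · simp

theorem moveCoord_self (i : Fin d) (x : UnitCube d) : moveCoord i x (x.1 i) (x.2 i) = x := by
  apply Subtype.ext
  simp [moveCoord]

theorem dist_moveCoord (i : Fin d) (x : UnitCube d) (t : ℝ) (ht : t ∈ Set.Icc (0 : ℝ) 1) :
    dist x (moveCoord i x t ht) = |x.1 i - t| := by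
  conv_lhs => rw [← moveCoord_self i x]
  convert dist_moveCoord_moveCoord i x (x.1 i) t (x.2 i) ht using 2
  simp [moveCoord]

theorem convex_cube : Convex ℝ {x : EuclideanSpace ℝ (Fin d) | ∀ i, x i ∈ Set.Icc (0 : ℝ) 1} := by
  intro x hx y hy a b ha hb hab i
  have := (convex_Icc (0 : ℝ) 1) (hx i) (hy i) ha hb hab
  simpa using this

theorem IsPreconnected.inter_frontier_nonempty {X : Type*} [TopologicalSpace X] {s G : Set X}
    (hs : IsPreconnected s) (h1 : (s ∩ G).Nonempty) (h2 : (s ∩ Gᶜ).Nonempty) :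
    (s ∩ frontier G).Nonempty := by
  by_contra hne
  rw [Set.not_nonempty_iff_eq_empty] at hne
  have hcov : s ⊆ interior G ∪ interior Gᶜ := by
    intro x hx
    by_contra h
    have : x ∈ s ∩ frontier G := by
      refine ⟨hx, ?_⟩
      rw [Set.mem_union, not_or, interior_compl, Set.mem_compl_iff, not_not] at h
      exact ⟨h.2, h.1⟩
    rw [hne] at this
    exact this
  obtain ⟨x, hxs, hxG⟩ := h1
  obtain ⟨y, hys, hyG⟩ := h2
  have hx : x ∈ interior G := by
    rcases hcov hxs with h | h
    · exact h
    · exact absurd hxG (interior_subset h)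
  have hy : y ∈ interior Gᶜ := by
    rcases hcov hys with h | h
    · exact absurd (interior_subset h) hyG
    · exact h
  obtain ⟨z, _, hz1, hz2⟩ := hs _ _ isOpen_interior isOpen_interior hcov ⟨x, hxs, hx⟩ ⟨y, hys, hy⟩
  exact interior_subset hz2 (interior_subset hz1)

/-- The cube is convex, so the segment from `x` to `w` stays inside it, and being connected it meets
the relative boundary. Upper bounds on distances to the boundary all come from exhibiting a point on
the other side. -/
theorem exists_frontier_dist_le {G : Set (UnitCube d)} {x w : UnitCube d} (hx : x ∈ G)
    (hw : w ∉ G) : ∃ z ∈ frontier G, dist x z ≤ dist x w ∧ dist w z ≤ dist x w := by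
  have hpre : IsPreconnected ((Subtype.val : UnitCube d → _) ⁻¹' segment ℝ x.1 w.1) := by
    have himg : Subtype.val '' ((Subtype.val : UnitCube d → _) ⁻¹' segment ℝ x.1 w.1) =
        segment ℝ x.1 w.1 :=
      Set.image_preimage_eq_of_subset
        fun z hz => ⟨⟨z, convex_cube.segment_subset x.2 w.2 hz⟩, rfl⟩
    refine Topology.IsInducing.subtypeVal.isPreconnected_image.1 ?_
    exact (congrArg IsPreconnected himg).mpr (convex_segment x.1 w.1).isPreconnected
  obtain ⟨z, hz, hzG⟩ := hpre.inter_frontier_nonempty ⟨x, left_mem_segment ℝ _ _, hx⟩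
    ⟨w, right_mem_segment ℝ _ _, hw⟩
  have h := dist_add_dist_of_mem_segment hz
  have h1 := dist_nonneg (x := x) (y := z)
  have h2 := dist_nonneg (x := z) (y := w)
  simp only [Subtype.dist_eq] at *
  refine ⟨z, hzG, by linarith, ?_⟩
  rw [dist_comm]
  linarith

theorem infDist_frontier_le_of_mem {G : Set (UnitCube d)} {x w : UnitCube d} (hx : x ∈ G)
    (hw : w ∉ G) : Metric.infDist x (frontier G) ≤ dist x w := by
  obtain ⟨z, hz, h, _⟩ := exists_frontier_dist_le hx hw
  exact (Metric.infDist_le_dist_of_mem hz).trans h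

theorem infDist_frontier_le_of_notMem {G : Set (UnitCube d)} {x w : UnitCube d} (hx : x ∉ G)
    (hw : w ∈ G) : Metric.infDist x (frontier G) ≤ dist x w := by
  obtain ⟨z, hz, _, h⟩ := exists_frontier_dist_le hw hx
  exact (Metric.infDist_le_dist_of_mem hz).trans (by rwa [dist_comm x w])

theorem closedBall_subset_innerCover {ε : ℝ} {G : Set (UnitCube d)} {y : UnitCube d}
    (hy : Metric.closedBall y ε ⊆ G) : Metric.closedBall y ε ⊆ innerCover ε G :=
  Set.subset_biUnion_of_mem (u := fun x => Metric.closedBall x ε) hy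

/-- Moving `x` along the coordinate axis towards the centre, it enters the ball after at most `η`.
-/
theorem infDist_innerCover_le {ε η t : ℝ} (hε : 0 ≤ ε) (hη : 0 ≤ η) {G : Set (UnitCube d)}
    (i : Fin d) (x : UnitCube d) (ht : t ∈ Set.Icc (0 : ℝ) 1) (htx : |t - x.1 i| ≤ ε + η)
    (hG : Metric.closedBall (moveCoord i x t ht) ε ⊆ G) :
    Metric.infDist x (innerCover ε G) ≤ η := by
  have hx := x.2 i
  have hsub := closedBall_subset_innerCover hG
  obtain ⟨s, hs, h1, h2⟩ : ∃ s ∈ Set.Icc (0 : ℝ) 1, |s - t| ≤ ε ∧ |x.1 i - s| ≤ η := by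
    rw [abs_le] at htx
    obtain ⟨hx0, hx1⟩ := hx
    obtain ⟨ht0, ht1⟩ := ht
    obtain h | h := le_total (x.1 i) t
    · refine ⟨max (x.1 i) (t - ε), ⟨?_, ?_⟩, abs_le.2 ⟨?_, ?_⟩, abs_le.2 ⟨?_, ?_⟩⟩ <;>
        rcases max_cases (x.1 i) (t - ε) with h' | h' <;> linarith
    · refine ⟨min (x.1 i) (t + ε), ⟨?_, ?_⟩, abs_le.2 ⟨?_, ?_⟩, abs_le.2 ⟨?_, ?_⟩⟩ <;>
        rcases min_cases (x.1 i) (t + ε) with h' | h' <;> linarith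
  have hmem : moveCoord i x s hs ∈ innerCover ε G := hsub (by
    rw [Metric.mem_closedBall, dist_moveCoord_moveCoord]; exact h1)
  refine (Metric.infDist_le_dist_of_mem hmem).trans ?_
  rwa [dist_moveCoord]

/-- To verify level set regularity it is enough to look at points of `G` that are arbitrarily
close to its complement. -/
theorem innerCover_regular_of_forall {ε η τ : ℝ} (hε : 0 < ε) (hη : 0 ≤ η) (hτ : 0 < τ)
    {G : Set (UnitCube d)} (i : Fin d) (hne : (frontier G).Nonempty)
    (h : ∀ x ∈ G, ∀ w ∉ G, dist x w < τ → ∃ t, ∃ ht : t ∈ Set.Icc (0 : ℝ) 1,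
      |t - x.1 i| ≤ ε + η ∧ Metric.closedBall (moveCoord i x t ht) ε ⊆ G) :
    (innerCover ε G).Nonempty ∧
      ∀ x ∈ frontier G, Metric.infDist x (innerCover ε G) ≤ η := by
  -- A boundary point need not lie in `G`; it is replaced by a nearby pair of a point of `G` and a
  -- point of the complement, and the error `σ` is let tend to `0`.
  have key : ∀ x ∈ frontier G, ∀ σ, 0 < σ → σ ≤ τ → ∃ y ∈ G, dist x y < σ ∧ ∃ t,
      ∃ ht : t ∈ Set.Icc (0 : ℝ) 1,
      |t - y.1 i| ≤ ε + η ∧ Metric.closedBall (moveCoord i y t ht) ε ⊆ G := by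
    intro x hx σ hσ hστ
    rw [frontier_eq_closure_inter_closure] at hx
    obtain ⟨y, hy, hxy⟩ := Metric.mem_closure_iff.1 hx.1 (σ / 2) (by positivity)
    obtain ⟨w, hw, hxw⟩ := Metric.mem_closure_iff.1 hx.2 (σ / 2) (by positivity)
    refine ⟨y, hy, by linarith, h y hy w hw ?_⟩
    linarith [dist_triangle_left y w x]
  constructor
  · obtain ⟨x, hx⟩ := hne
    obtain ⟨y, _, _, t, ht, _, hb⟩ := key x hx τ hτ le_rfl
    exact ⟨_, closedBall_subset_innerCover hb (Metric.mem_closedBall_self hε.le)⟩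
  · intro x hx
    refine le_of_forall_pos_le_add fun σ hσ => ?_
    obtain ⟨y, _, hxy, t, ht, h1, hb⟩ := key x hx (min σ τ) (lt_min hσ hτ) (min_le_right _ _)
    have h2 := infDist_innerCover_le hε.le hη i y ht h1 hb
    have h3 := Metric.infDist_le_infDist_add_dist (s := innerCover ε G) (x := x) (y := y)
    linarith [min_le_left σ τ]

/-- The triangle inequality through `A`. For empty `A` the convention gives the diameter of the
cube, which is at least `1 ≥ s` because there is a coordinate `i`. -/
theorem le_hausdorffError_add {A B C : Set (UnitCube d)} {s : ℝ≥0∞} (hB : B.Nonempty)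
    (hC : C.Nonempty) (hs : s ≤ Metric.hausdorffEDist B C) (hs1 : s ≤ 1) (i : Fin d) :
    s ≤ hausdorffError A B + hausdorffError A C := by
  by_cases hA : A.Nonempty
  · rw [hausdorffError, hausdorffError, if_pos ⟨hA, hB⟩, if_pos ⟨hA, hC⟩]
    refine hs.trans (Metric.hausdorffEDist_triangle.trans (add_le_add_left ?_ _))
    rw [Metric.hausdorffEDist_comm]
  · rw [hausdorffError, if_neg (fun h => hA h.1)]
    refine hs1.trans (le_add_right ?_)
    obtain ⟨x, _⟩ := hB
    have h0 : (0 : ℝ) ∈ Set.Icc (0 : ℝ) 1 := by simp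
    have h1 : (1 : ℝ) ∈ Set.Icc (0 : ℝ) 1 := by simp
    have := Metric.edist_le_ediam_of_mem (Set.mem_univ (moveCoord i x 0 h0))
      (Set.mem_univ (moveCoord i x 1 h1))
    rw [edist_dist, dist_moveCoord_moveCoord] at this
    simpa using this

theorem ofReal_le_hausdorffEDist {A B : Set (UnitCube d)} {s : ℝ} {c : UnitCube d}
    (hc : c ∈ closure A) (hB : ∀ y ∈ B, s ≤ dist c y) :
    ENNReal.ofReal s ≤ Metric.hausdorffEDist A B := by
  rw [← Metric.hausdorffEDist_closure_left]
  refine le_trans ?_ (Metric.infEDist_le_hausdorffEDist_of_mem hc)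
  refine Metric.le_infEDist.2 fun y hy => ?_
  rw [edist_dist]
  exact ENNReal.ofReal_le_ofReal (hB y hy)

end Cube

/-! ### Second moment bound for mixtures of product measures. -/

section Testing

variable {Ω : Type*} [MeasurableSpace Ω]

theorem lintegral_pi_prod_eq_prod {n : ℕ} (ν : Measure Ω) [IsProbabilityMeasure ν]
    (φ : Fin n → Ω → ℝ≥0∞) (hφ : ∀ i, Measurable (φ i)) :
    ∫⁻ x, ∏ i, φ i (x i) ∂(Measure.pi fun _ : Fin n => ν) = ∏ i, ∫⁻ y, φ i y ∂ν := by
  rw [ProbabilityTheory.lintegral_prod_eq_prod_lintegral_of_indepFun Finset.univ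
    (fun i (x : Fin n → Ω) => φ i (x i))
    (ProbabilityTheory.iIndepFun_pi fun i => (hφ i).aemeasurable)
    (fun i => (hφ i).comp (measurable_pi_apply i))]
  refine Finset.prod_congr rfl fun i _ => ?_
  exact (measurePreserving_eval (fun _ : Fin n => ν) i).lintegral_comp (hφ i)

theorem pi_withDensity_eq {n : ℕ} (ν : Measure Ω) [IsProbabilityMeasure ν] {φ : Ω → ℝ≥0∞}
    (hφ : Measurable φ) (hφ1 : ∫⁻ x, φ x ∂ν = 1) :
    Measure.pi (fun _ : Fin n => ν.withDensity φ) =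
      (Measure.pi fun _ : Fin n => ν).withDensity fun x => ∏ i, φ (x i) := by
  have : IsProbabilityMeasure (ν.withDensity φ) := ⟨by simpa using hφ1⟩
  refine (Measure.pi_eq fun s hs => ?_)
  rw [withDensity_apply _ (MeasurableSet.univ_pi hs),
    ← lintegral_indicator (MeasurableSet.univ_pi hs)]
  have h : ∀ x : Fin n → Ω, (Set.univ.pi s).indicator (fun x => ∏ i, φ (x i)) x =
      ∏ i, (s i).indicator φ (x i) := by
    intro x
    by_cases hx : x ∈ Set.univ.pi s
    · rw [Set.indicator_of_mem hx]
      exact Finset.prod_congr rfl fun i _ => (Set.indicator_of_mem (hx i trivial) _).symm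
    · rw [Set.indicator_of_notMem hx]
      simp only [Set.mem_univ_pi, not_forall] at hx
      obtain ⟨i, hi⟩ := hx
      exact (Finset.prod_eq_zero (Finset.mem_univ i) (Set.indicator_of_notMem hi _)).symm
  simp_rw [h]
  rw [lintegral_pi_prod_eq_prod ν _ fun i => hφ.indicator (hs i)]
  refine Finset.prod_congr rfl fun i _ => ?_
  rw [lintegral_indicator (hs i), withDensity_apply _ (hs i)]

theorem integral_pi_withDensity {n : ℕ} (ν : Measure Ω) [IsProbabilityMeasure ν] {φ : Ω → ℝ}
    (hφ : Measurable φ) (hφ0 : ∀ x, 0 ≤ φ x) (hφi : Integrable φ ν) (hφ1 : ∫ x, φ x ∂ν = 1)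
    (T : (Fin n → Ω) → ℝ) :
    ∫ x, T x ∂(Measure.pi fun _ : Fin n => ν.withDensity fun y => ENNReal.ofReal (φ y)) =
      ∫ x, (∏ i, φ (x i)) * T x ∂(Measure.pi fun _ : Fin n => ν) := by
  rw [pi_withDensity_eq ν hφ.ennreal_ofReal
    (by rw [← ofReal_integral_eq_lintegral_ofReal hφi (.of_forall hφ0), hφ1, ENNReal.ofReal_one]),
    integral_withDensity_eq_integral_toReal_smul]
  · refine integral_congr_ae (.of_forall fun x => ?_)
    simp only [smul_eq_mul, ENNReal.toReal_prod]
    congr 1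
    exact Finset.prod_congr rfl fun i _ => ENNReal.toReal_ofReal (hφ0 _)
  · exact Finset.measurable_fun_prod _ fun i _ => hφ.ennreal_ofReal.comp (measurable_pi_apply i)
  · exact .of_forall fun x => ENNReal.prod_lt_top fun i _ => ENNReal.ofReal_lt_top

/-- Comparison of the average of `T` under product measures with densities `φ j`, uncorrelated
under `ν`, with its mean under the product of `ν`. -/
theorem sum_integral_pi_withDensity_le {n : ℕ} {ι : Type*} (J : Finset ι) (hJ : J.Nonempty)
    (ν : Measure Ω) [IsProbabilityMeasure ν] {φ : ι → Ω → ℝ} {B V s : ℝ}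
    (hφ : ∀ j, Measurable (φ j)) (hφ0 : ∀ j x, 0 ≤ φ j x) (hφB : ∀ j x, φ j x ≤ B)
    (hφ1 : ∀ j ∈ J, ∫ x, φ j x ∂ν = 1)
    (hcorr : ∀ j ∈ J, ∀ k ∈ J, j ≠ k → ∫ x, φ j x * φ k x ∂ν = 1)
    (hV : ∀ j ∈ J, ∫ x, φ j x * φ j x ∂ν ≤ 1 + V)
    {T : (Fin n → Ω) → ℝ} (hT : Measurable T) (hT0 : ∀ x, 0 ≤ T x) (hTs : ∀ x, T x ≤ s) :
    ∑ j ∈ J, ∫ x, T x ∂(Measure.pi fun _ : Fin n =>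
        ν.withDensity fun y => ENNReal.ofReal (φ j y)) ≤
      J.card * ∫ x, T x ∂(Measure.pi fun _ : Fin n => ν) + s * (J.card / 4 + (1 + V) ^ n) := by
  classical
  set P := Measure.pi fun _ : Fin n => ν with hP
  have hM : (0 : ℝ) < J.card := by exact_mod_cast hJ.card_pos
  set M : ℝ := (J.card : ℝ)
  have hs : 0 ≤ s := by
    have : Nonempty (Fin n → Ω) := P.nonempty_of_neZero
    exact (hT0 (Classical.arbitrary _)).trans (hTs _)
  have hφi : ∀ j, Integrable (φ j) ν := fun j =>
    .of_bound (hφ j).aestronglyMeasurable B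
      (.of_forall fun x => by rw [Real.norm_of_nonneg (hφ0 j x)]; exact hφB j x)
  have hB : 0 ≤ B := by
    obtain ⟨j, _⟩ := hJ
    have : Nonempty Ω := ν.nonempty_of_neZero
    exact (hφ0 j (Classical.arbitrary _)).trans (hφB j _)
  let Λ : ι → (Fin n → Ω) → ℝ := fun j x => ∏ i, φ j (x i)
  have hΛm : ∀ j, Measurable (Λ j) := fun j =>
    Finset.measurable_fun_prod _ fun i _ => (hφ j).comp (measurable_pi_apply i)
  have hΛ0 : ∀ j x, 0 ≤ Λ j x := fun j x => Finset.prod_nonneg fun i _ => hφ0 j _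
  have hΛB : ∀ j x, Λ j x ≤ B ^ n := fun j x => by
    refine (Finset.prod_le_prod (fun i _ => hφ0 j _) fun i _ => hφB j (x i)).trans ?_
    simp
  have hΛi : ∀ j, Integrable (Λ j) P := fun j =>
    .of_bound (hΛm j).aestronglyMeasurable (B ^ n)
      (.of_forall fun x => by rw [Real.norm_of_nonneg (hΛ0 j x)]; exact hΛB j x)
  have hTi : Integrable T P := .of_bound hT.aestronglyMeasurable s
      (.of_forall fun x => by rw [Real.norm_of_nonneg (hT0 x)]; exact hTs x)
  have hΛTi : ∀ j, Integrable (fun x => Λ j x * T x) P := fun j =>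
    .of_bound ((hΛm j).mul hT).aestronglyMeasurable (B ^ n * s)
      (.of_forall fun x => by
        rw [Real.norm_of_nonneg (mul_nonneg (hΛ0 j x) (hT0 x))]
        exact mul_le_mul (hΛB j x) (hTs x) (hT0 x) (by positivity))
  have hΛΛi : ∀ j k, Integrable (fun x => Λ j x * Λ k x) P := fun j k =>
    .of_bound ((hΛm j).mul (hΛm k)).aestronglyMeasurable (B ^ n * B ^ n)
      (.of_forall fun x => by
        rw [Real.norm_of_nonneg (mul_nonneg (hΛ0 j x) (hΛ0 k x))]
        exact mul_le_mul (hΛB j x) (hΛB k x) (hΛ0 k x) (by positivity))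
  have hΛ1 : ∀ j ∈ J, ∫ x, Λ j x ∂P = 1 := fun j hj => by
    rw [hP, integral_fintype_prod_eq_pow, hφ1 j hj, one_pow]
  have hΛΛ : ∀ j k, ∫ x, Λ j x * Λ k x ∂P = (∫ x, φ j x * φ k x ∂ν) ^ n := fun j k => by
    simp only [Λ, ← Finset.prod_mul_distrib]
    rw [hP, integral_fintype_prod_eq_pow (fun y => φ j y * φ k y), Fintype.card_fin]
  -- `S / M` is the likelihood ratio of the mixture; it has mean `1`, and the off-diagonal terms
  -- contribute no covariance, so `S` has variance at most `M * (1 + V) ^ n`.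
  let S : (Fin n → Ω) → ℝ := fun x => ∑ j ∈ J, Λ j x
  have hSi : Integrable S P := integrable_finsetSum _ fun j _ => hΛi j
  have hS1 : ∫ x, S x ∂P = M := by
    rw [integral_finsetSum _ fun j _ => hΛi j, Finset.sum_congr rfl hΛ1]
    simp [M]
  have hSS : ∀ x, S x ^ 2 = ∑ j ∈ J, ∑ k ∈ J, Λ j x * Λ k x := fun x => by
    rw [sq, Finset.sum_mul_sum]
  have hSSi : Integrable (fun x => S x ^ 2) P := by
    simp_rw [hSS]
    exact integrable_finsetSum _ fun j _ => integrable_finsetSum _ fun k _ => hΛΛi j k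
  have hS2 : ∫ x, S x ^ 2 ∂P ≤ M * (1 + V) ^ n + M ^ 2 := by
    simp_rw [hSS]
    rw [integral_finsetSum _ fun j _ => integrable_finsetSum _ fun k _ => hΛΛi j k]
    have hrow : ∀ j ∈ J, ∫ x, ∑ k ∈ J, Λ j x * Λ k x ∂P ≤ (1 + V) ^ n + M := by
      intro j hj
      rw [integral_finsetSum _ fun k _ => hΛΛi j k, ← Finset.add_sum_erase _ _ hj]
      refine add_le_add ?_ ?_
      · rw [hΛΛ]
        exact pow_le_pow_left₀ (integral_nonneg fun x => mul_nonneg (hφ0 j x) (hφ0 j x)) (hV j hj) n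
      · have : ∀ k ∈ J.erase j, ∫ x, Λ j x * Λ k x ∂P = 1 := fun k hk => by
          rw [Finset.mem_erase] at hk
          rw [hΛΛ, hcorr j hj k hk.2 hk.1.symm, one_pow]
        rw [Finset.sum_congr rfl this]
        simp only [Finset.sum_const, nsmul_eq_mul, mul_one, M]
        exact_mod_cast Finset.card_le_card (Finset.erase_subset _ _)
    refine (Finset.sum_le_sum hrow).trans (le_of_eq ?_)
    rw [Finset.sum_const, nsmul_eq_mul]
    ring
  have hpt : ∀ x, S x * T x ≤ M * T x + s * (S x ^ 2 / M - 2 * S x + (M + M / 4)) := by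
    intro x
    have h1 : (S x - M) * T x ≤ s * ((S x - M) ^ 2 / M + M / 4) := by
      -- This is `0 ≤ (|S x - M| - M / 2) ^ 2` divided by `M`; it replaces Cauchy–Schwarz and keeps
      -- everything linear in second moments.
      have h2 : |S x - M| ≤ (S x - M) ^ 2 / M + M / 4 := by
        rw [← sq_abs, div_add' _ _ _ hM.ne', le_div_iff₀ hM]
        nlinarith [sq_nonneg (|S x - M| - M / 2)]
      calc (S x - M) * T x ≤ |S x - M| * T x :=
            mul_le_mul_of_nonneg_right (le_abs_self _) (hT0 x)
        _ ≤ |S x - M| * s := mul_le_mul_of_nonneg_left (hTs x) (abs_nonneg _)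
        _ ≤ _ := by rw [mul_comm]; exact mul_le_mul_of_nonneg_left h2 hs
    have h3 : (S x - M) ^ 2 / M = S x ^ 2 / M - 2 * S x + M := by field_simp; ring
    rw [h3] at h1
    linarith
  have hsum : ∑ j ∈ J, ∫ x, T x ∂(Measure.pi fun _ : Fin n =>
      ν.withDensity fun y => ENNReal.ofReal (φ j y)) = ∫ x, S x * T x ∂P := by
    rw [Finset.sum_congr rfl fun j hj =>
      integral_pi_withDensity ν (hφ j) (hφ0 j) (hφi j) (hφ1 j hj) T]
    simp only [S, Finset.sum_mul]
    rw [integral_finsetSum _ fun j _ => hΛTi j]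
  have hSTi : Integrable (fun x => S x * T x) P := by
    simp only [S, Finset.sum_mul]
    exact integrable_finsetSum _ fun j _ => hΛTi j
  have hq0 : Integrable (fun x => S x ^ 2 / M - 2 * S x) P :=
    (hSSi.div_const M).sub (hSi.const_mul 2)
  have hq : Integrable (fun x => S x ^ 2 / M - 2 * S x + (M + M / 4)) P :=
    hq0.add (integrable_const _)
  rw [hsum]
  refine (integral_mono hSTi ((hTi.const_mul M).add (hq.const_mul s)) hpt).trans ?_
  rw [integral_add' (hTi.const_mul M) (hq.const_mul s), integral_const_mul, integral_const_mul,
    integral_add hq0 (integrable_const _), integral_sub (hSSi.div_const M) (hSi.const_mul 2),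
    integral_div, integral_const_mul, hS1]
  simp only [integral_const, probReal_univ, one_smul]
  have h4 : (∫ x, S x ^ 2 ∂P) / M ≤ (1 + V) ^ n + M := by
    rw [div_le_iff₀ hM]
    linarith
  have h5 : s * ((∫ x, S x ^ 2 ∂P) / M - 2 * M + (M + M / 4)) ≤ s * (M / 4 + (1 + V) ^ n) :=
    mul_le_mul_of_nonneg_left (by linarith) hs
  linarith

end Testing

/-! ### From indistinguishability to a lower bound on the risk. -/

section Minimax

variable {d : ℕ}

theorem IsBoundedDensity.isProbabilityMeasure {fmax : ℝ} {f : UnitCube d → ℝ}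
    (hf : IsBoundedDensity fmax f) :
    IsProbabilityMeasure ((cubeVolume d).withDensity fun x => ENNReal.ofReal (f x)) :=
  ⟨by simpa using hf.lintegral_eq_one⟩

theorem minimaxRisk_anti {n : ℕ} {γ : ℝ} {𝓕 𝓕' : Set (UnitCube d → ℝ)} (h : 𝓕 ⊆ 𝓕') :
    minimaxRisk n γ 𝓕 ≤ minimaxRisk n γ 𝓕' :=
  iInf₂_mono fun _ _ => biSup_mono h

/-- Let `Q` be the worst risk of an estimator. Its truncated error `T` for `f₀` has mean at most `Q`
under `f₀` and, since the level sets are `s` apart, at least `s - Q` under each `f j`. The mixture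
bound says these means differ on average by at most `s / 2`, so `s - Q ≤ Q + s / 2`. -/
theorem ofReal_le_minimaxRisk {n : ℕ} {γ fmax : ℝ} {𝓕 : Set (UnitCube d → ℝ)} (i : Fin d)
    {ι : Type*} (J : Finset ι) (hJ : J.Nonempty) {f₀ : UnitCube d → ℝ}
    {f φ : ι → UnitCube d → ℝ} {B V s : ℝ}
    (hf₀ : IsBoundedDensity fmax f₀) (hf : ∀ j ∈ J, IsBoundedDensity fmax (f j))
    (hf₀𝓕 : f₀ ∈ 𝓕) (hf𝓕 : ∀ j ∈ J, f j ∈ 𝓕)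
    (hfφ : ∀ j ∈ J, ∀ x, f j x = f₀ x * φ j x)
    (hφ : ∀ j, Measurable (φ j)) (hφ0 : ∀ j x, 0 ≤ φ j x) (hφB : ∀ j x, φ j x ≤ B)
    (hφ1 : ∀ j ∈ J, ∫ x, φ j x ∂((cubeVolume d).withDensity fun x => ENNReal.ofReal (f₀ x)) = 1)
    (hcorr : ∀ j ∈ J, ∀ k ∈ J, j ≠ k →
      ∫ x, φ j x * φ k x ∂((cubeVolume d).withDensity fun x => ENNReal.ofReal (f₀ x)) = 1)
    (hV : ∀ j ∈ J,
      ∫ x, φ j x * φ j x ∂((cubeVolume d).withDensity fun x => ENNReal.ofReal (f₀ x)) ≤ 1 + V)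
    (hn : (1 + V) ^ n ≤ J.card / 4) (hs0 : 0 ≤ s) (hs1 : s ≤ 1)
    (hne₀ : (levelSet f₀ γ).Nonempty) (hne : ∀ j ∈ J, (levelSet (f j) γ).Nonempty)
    (hs : ∀ j ∈ J,
      ENNReal.ofReal s ≤ Metric.hausdorffEDist (levelSet f₀ γ) (levelSet (f j) γ)) :
    ENNReal.ofReal (s / 4) ≤ minimaxRisk n γ 𝓕 := by
  refine le_iInf₂ fun Ghat hG => ?_
  set Q := ⨆ f ∈ 𝓕, ∫⁻ X, hausdorffError (Ghat X) (levelSet f γ) ∂(sampleLaw n f) with hQ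
  obtain hQtop | hQtop := eq_or_ne Q ⊤
  · rw [hQtop]; exact le_top
  have hprob₀ := hf₀.isProbabilityMeasure
  have hM : (0 : ℝ) < J.card := by exact_mod_cast hJ.card_pos
  let D₀ : (Fin n → UnitCube d) → ℝ≥0∞ := fun X => hausdorffError (Ghat X) (levelSet f₀ γ)
  have hD₀ : Measurable D₀ := hG _
  -- Truncation at `s` makes the error bounded, as the mixture bound requires, and loses nothing in
  -- the triangle inequality.
  let T : (Fin n → UnitCube d) → ℝ := fun X => (min (D₀ X) (ENNReal.ofReal s)).toReal
  have hTm : Measurable T := (hD₀.min measurable_const).ennreal_toReal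
  have hfin : ∀ X, min (D₀ X) (ENNReal.ofReal s) ≠ ⊤ := fun X =>
    ((min_le_right _ _).trans_lt ENNReal.ofReal_lt_top).ne
  have hT0 : ∀ X, 0 ≤ T X := fun X => ENNReal.toReal_nonneg
  have hTs : ∀ X, T X ≤ s := fun X =>
    (ENNReal.toReal_mono ENNReal.ofReal_ne_top (min_le_right _ _)).trans_eq
      (ENNReal.toReal_ofReal hs0)
  have hT₀ : ∫ X, T X ∂(sampleLaw n f₀) ≤ Q.toReal := by
    rw [integral_toReal (hD₀.min measurable_const).aemeasurable
      (.of_forall fun X => (hfin X).lt_top)]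
    refine ENNReal.toReal_mono hQtop ?_
    refine (lintegral_mono fun X => min_le_left _ _).trans ?_
    exact le_biSup (fun f => ∫⁻ X, hausdorffError (Ghat X) (levelSet f γ) ∂(sampleLaw n f)) hf₀𝓕
  have hTj : ∀ j ∈ J, s - Q.toReal ≤ ∫ X, T X ∂(sampleLaw n (f j)) := by
    intro j hj
    have hprob := (hf j hj).isProbabilityMeasure
    have : IsProbabilityMeasure (sampleLaw n (f j)) := by unfold sampleLaw; infer_instance
    have hTi : Integrable T (sampleLaw n (f j)) := .of_bound hTm.aestronglyMeasurable s
      (.of_forall fun x => by rw [Real.norm_of_nonneg (hT0 x)]; exact hTs x)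
    have h1 : ∀ X, ENNReal.ofReal (s - T X) ≤ hausdorffError (Ghat X) (levelSet (f j) γ) := by
      intro X
      have h2 := le_hausdorffError_add (A := Ghat X) hne₀ (hne j hj) (hs j hj)
        (by simpa using ENNReal.ofReal_le_ofReal hs1) i
      rw [ENNReal.ofReal_sub _ (hT0 X), ENNReal.ofReal_toReal (hfin X), tsub_le_iff_left]
      obtain h | h := le_total (D₀ X) (ENNReal.ofReal s)
      · rw [min_eq_left h]; exact h2
      · rw [min_eq_right h]; exact le_self_add
    have h3 : ∫ X, (s - T X) ∂(sampleLaw n (f j)) ≤ Q.toReal := by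
      rw [integral_eq_lintegral_of_nonneg_ae (.of_forall fun X => sub_nonneg.2 (hTs X))
        (measurable_const.sub hTm).aestronglyMeasurable]
      refine ENNReal.toReal_mono hQtop ?_
      refine (lintegral_mono h1).trans ?_
      exact le_biSup (fun f => ∫⁻ X, hausdorffError (Ghat X) (levelSet f γ) ∂(sampleLaw n f))
        (hf𝓕 j hj)
    rw [integral_sub (integrable_const _) hTi] at h3
    simp only [integral_const, probReal_univ, one_smul] at h3
    linarith
  have hlaw : ∀ j ∈ J, sampleLaw n (f j) = Measure.pi fun _ : Fin n =>
      ((cubeVolume d).withDensity fun x => ENNReal.ofReal (f₀ x)).withDensity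
        fun y => ENNReal.ofReal (φ j y) := by
    intro j hj
    rw [← withDensity_mul _ hf₀.measurable.ennreal_ofReal (hφ j).ennreal_ofReal]
    unfold sampleLaw
    congr 1
    funext _
    congr 1
    funext x
    rw [Pi.mul_apply, ← ENNReal.ofReal_mul (hf₀.nonneg x), hfφ j hj]
  have hmain := sum_integral_pi_withDensity_le J hJ
    ((cubeVolume d).withDensity fun x => ENNReal.ofReal (f₀ x)) hφ hφ0 hφB hφ1 hcorr hV hTm hT0 hTs
  have hlow := Finset.card_nsmul_le_sum J _ _ hTj
  rw [nsmul_eq_mul] at hlow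
  have h6 : ∫ X, T X ∂(Measure.pi fun _ : Fin n =>
      (cubeVolume d).withDensity fun x => ENNReal.ofReal (f₀ x)) ≤ Q.toReal := hT₀
  have h7 : (J.card : ℝ) * (s - Q.toReal) ≤ J.card * (Q.toReal + s / 2) := by
    refine hlow.trans (le_trans (le_of_eq ?_) (hmain.trans ?_))
    · exact Finset.sum_congr rfl fun j hj => by rw [hlaw j hj]
    nlinarith [mul_le_mul_of_nonneg_left h6 hM.le, mul_le_mul_of_nonneg_left hn hs0]
  have h8 := le_of_mul_le_mul_left h7 hM
  rw [← ENNReal.ofReal_toReal hQtop]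
  exact ENNReal.ofReal_le_ofReal (by linarith)

end Minimax

/-! ### Lebesgue measure of sets defined by one coordinate. -/

section CubeVolume

variable {d : ℕ}

theorem measurableSet_cube :
    MeasurableSet {x : EuclideanSpace ℝ (Fin d) | ∀ i, x i ∈ Set.Icc (0 : ℝ) 1} := by
  simp only [Set.ofPred_forall]
  exact MeasurableSet.iInter fun i => measurableSet_Icc.preimage (by fun_prop)

theorem measurable_coord (i : Fin d) : Measurable fun x : UnitCube d => x.1 i := by
  have : Measurable fun x : EuclideanSpace ℝ (Fin d) => x i := by fun_prop
  exact this.comp measurable_subtype_coe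

theorem cubeVolume_apply (s : Set (UnitCube d)) :
    cubeVolume d s = volume (Subtype.val '' s : Set (EuclideanSpace ℝ (Fin d))) :=
  comap_subtype_coe_apply measurableSet_cube volume s

theorem cubeVolume_preimage {H : Set (EuclideanSpace ℝ (Fin d))}
    (hH : H ⊆ {x | ∀ i, x i ∈ Set.Icc (0 : ℝ) 1}) :
    cubeVolume d (Subtype.val ⁻¹' H) = volume H := by
  rw [cubeVolume_apply, Set.image_preimage_eq_of_subset]
  exact fun x hx => ⟨⟨x, hH hx⟩, rfl⟩

theorem cubeVolume_coord_mem (i : Fin d) {T : Set ℝ} (hT : MeasurableSet T) :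
    cubeVolume d {x | x.1 i ∈ T} = volume (T ∩ Set.Icc 0 1) := by
  classical
  let U : Fin d → Set ℝ := Function.update (fun _ => Set.Icc 0 1) i (T ∩ Set.Icc 0 1)
  have hU : ∀ j, MeasurableSet (U j) := by
    intro j
    by_cases h : j = i
    · subst h; simpa [U] using hT.inter measurableSet_Icc
    · simp [U, h]
  have himg : (Subtype.val '' {x : UnitCube d | x.1 i ∈ T} : Set (EuclideanSpace ℝ (Fin d))) =
      WithLp.ofLp ⁻¹' (Set.univ.pi U) := by
    ext y
    simp only [Set.mem_image, Set.mem_ofPred_eq, Set.mem_preimage, Set.mem_univ_pi]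
    constructor
    · rintro ⟨x, hx, rfl⟩ j
      by_cases h : j = i
      · subst h; simpa [U] using ⟨hx, x.2 j⟩
      · simpa [U, h] using x.2 j
    · intro h
      have hi : y.ofLp i ∈ T ∩ Set.Icc 0 1 := by simpa [U] using h i
      refine ⟨⟨y, fun j => ?_⟩, hi.1, rfl⟩
      by_cases hj : j = i
      · subst hj; exact hi.2
      · simpa [U, hj] using h j
  rw [cubeVolume_apply, himg, (PiLp.volume_preserving_ofLp (Fin d)).measure_preimage
    (MeasurableSet.univ_pi hU).nullMeasurableSet, volume_pi_pi,
    ← Finset.mul_prod_erase _ _ (Finset.mem_univ i)]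
  rw [Finset.prod_eq_one, mul_one]
  · simp [U]
  · intro j hj
    simp [U, Finset.ne_of_mem_erase hj]

instance isProbabilityMeasure_cubeVolume : IsProbabilityMeasure (cubeVolume d) := by
  constructor
  rw [cubeVolume_apply, Set.image_univ, Subtype.range_coe_subtype]
  have himg : {x : EuclideanSpace ℝ (Fin d) | ∀ i, x i ∈ Set.Icc (0 : ℝ) 1} =
      WithLp.ofLp ⁻¹' (Set.univ.pi fun _ : Fin d => Set.Icc (0 : ℝ) 1) := by
    ext y
    simp only [Set.mem_ofPred_eq, Set.mem_preimage, Set.mem_univ_pi]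
  rw [himg, (PiLp.volume_preserving_ofLp (Fin d)).measure_preimage
    (MeasurableSet.univ_pi fun _ => measurableSet_Icc).nullMeasurableSet, volume_pi_pi]
  simp

end CubeVolume

/-! ### The unperturbed one-dimensional profile. -/

/-- Parameters of a density depending on one coordinate, whose level set consists of `N` slabs of
half-width `1 / (2 * F * N)`, the first of which is cut along a porous finite set `K`. -/
structure Layout where
  (α γ F C₁ lam r : ℝ)
  N : ℕ
  K : Finset ℝ
  α_pos : 0 < α
  γ_pos : 0 < γ
  γ_lt : γ < F
  one_lt : 1 < F
  C₁_pos : 0 < C₁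
  N_pos : 0 < N
  net : 3 * (C₁ * (1 / (N : ℝ)) ^ α) ≤ γ / 2
  net' : 3 * (C₁ * (1 / (N : ℝ)) ^ α) ≤ F - γ
  mass : 1 / (N : ℝ) ≤ γ / 2 * (1 - 1 / F)
  lam_pos : 0 < lam
  lam_le : lam ≤ 1
  r_pos : 0 < r
  r_le : r ≤ 1 / (2 * F * N) / 8 / 4
  K_subset : ∀ k ∈ K, 1 / (2 * (N : ℝ)) + 1 / (2 * F * N) / 8 ≤ k ∧
    k ≤ 1 / (2 * (N : ℝ)) + 3 * (1 / (2 * F * N) / 8)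
  porous : IsPorous lam (K : Set ℝ)
  sep : ∀ k ∈ K, ∀ k' ∈ K, k ≠ k' → 4 * r ≤ |k - k'|

namespace Layout

variable (L : Layout)

/-- Half-width of the slabs. -/
noncomputable def W : ℝ := 1 / (2 * L.F * L.N)

/-- The basic small length. -/
noncomputable def l : ℝ := L.W / 8

/-- Centre of the `i`-th slab. -/
noncomputable def ctr (i : ℕ) : ℝ := (i + 1 / 2) / L.N

/-- The slabs other than the first one. -/
def outer : Set ℝ := ⋃ i ∈ Finset.Ico 1 L.N, Set.Icc (L.ctr i - L.W) (L.ctr i + L.W)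

/-- The right half of the first slab. -/
def inner : Set ℝ := Set.Icc (L.ctr 0) (L.ctr 0 + L.W)

/-- The left half of the first slab. -/
def low : Set ℝ := Set.Ico (L.ctr 0 - L.W) (L.ctr 0)

/-- The coordinates of points in the level set. -/
def good : Set ℝ := L.outer ∪ (L.inner \ L.K)

/-- The coordinates of the inner part of the boundary. -/
def cut : Set ℝ := insert (L.ctr 0) (L.K : Set ℝ)

open Classical in
/-- The one-dimensional profile, with value `b` off the slabs. -/
noncomputable def base (b t : ℝ) : ℝ :=
  if t ∈ L.outer then L.F
  else if t ∈ L.inner then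
    (if t ∈ L.K then L.γ / 2 else L.γ + L.C₁ * Metric.infDist t L.cut ^ L.α)
  else if t ∈ L.low then L.γ - L.C₁ * (L.ctr 0 - t) ^ L.α
  else b

theorem N_pos' : (0 : ℝ) < L.N := by exact_mod_cast L.N_pos

theorem F_pos : 0 < L.F := zero_lt_one.trans L.one_lt

theorem W_pos : 0 < L.W := by
  have := L.N_pos'; have := L.F_pos
  unfold W; positivity

theorem l_pos : 0 < L.l := div_pos L.W_pos (by norm_num)

theorem W_eq : L.W = 8 * L.l := by unfold l; ring

theorem two_W_lt : 2 * L.W < 1 / L.N := by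
  have h := L.N_pos'
  have hF := L.F_pos
  have : 2 * L.W = 1 / L.N * (1 / L.F) := by unfold W; field_simp
  rw [this]
  exact mul_lt_of_lt_one_right (by positivity) ((div_lt_one hF).2 L.one_lt)

theorem ctr_zero : L.ctr 0 = 1 / (2 * (L.N : ℝ)) := by
  unfold ctr; field_simp; simp

theorem two_ctr_zero : 2 * L.ctr 0 = 1 / L.N := by
  have := L.N_pos'
  rw [ctr_zero]; field_simp

theorem W_lt_ctr : L.W < L.ctr 0 := by linarith [L.two_W_lt, L.two_ctr_zero]

theorem ctr_eq (i : ℕ) : L.ctr i = L.ctr 0 + i * (1 / L.N) := by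
  unfold ctr; field_simp; push_cast; ring

theorem ctr_le {i : ℕ} (hi : i < L.N) : L.ctr i + L.W < 1 := by
  have h1 : ((i : ℝ) + 1) * (1 / L.N) ≤ 1 := by
    rw [mul_one_div, div_le_one L.N_pos']
    exact_mod_cast hi
  rw [ctr_eq]
  linarith [L.W_lt_ctr, L.two_ctr_zero]

theorem ctr_sub_pos (i : ℕ) : 0 < L.ctr i - L.W := by
  rw [ctr_eq]
  have := L.N_pos'
  have : 0 ≤ (i : ℝ) * (1 / L.N) := by positivity
  linarith [L.W_lt_ctr]

theorem inv_N_le_one : 1 / (L.N : ℝ) ≤ 1 := by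
  rw [div_le_one L.N_pos']
  exact_mod_cast L.N_pos

theorem mem_Icc_of_slab {i : ℕ} (hi : i < L.N) {t : ℝ}
    (ht : t ∈ Set.Icc (L.ctr i - L.W) (L.ctr i + L.W)) : t ∈ Set.Icc (0 : ℝ) 1 :=
  ⟨(L.ctr_sub_pos i).le.trans ht.1, ht.2.trans (L.ctr_le hi).le⟩

theorem mem_outer {t : ℝ} : t ∈ L.outer ↔
    ∃ i, 1 ≤ i ∧ i < L.N ∧ t ∈ Set.Icc (L.ctr i - L.W) (L.ctr i + L.W) := by
  simp only [outer, Set.mem_iUnion, Finset.mem_Ico, exists_prop, and_assoc]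

theorem gap {i j : ℕ} (h : i < j) : L.ctr i + L.W < L.ctr j - L.W := by
  have h1 : ((i : ℝ) + 1) ≤ j := by exact_mod_cast h
  have h2 := mul_le_mul_of_nonneg_right h1 (one_div_pos.2 L.N_pos').le
  rw [ctr_eq, ctr_eq L j]
  linarith [L.two_W_lt]

theorem lt_of_mem_outer {t : ℝ} (ht : t ∈ L.outer) : L.ctr 0 + L.W < t := by
  obtain ⟨i, hi, _, h⟩ := L.mem_outer.1 ht
  exact (L.gap (by lia)).trans_le h.1

theorem notMem_outer {t : ℝ} (ht : t ≤ L.ctr 0 + L.W) : t ∉ L.outer :=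
  fun h => (L.lt_of_mem_outer h).not_ge ht

theorem K_bounds {k : ℝ} (hk : k ∈ L.K) : L.ctr 0 + L.l ≤ k ∧ k ≤ L.ctr 0 + 3 * L.l := by
  rw [ctr_zero]; exact L.K_subset k hk

theorem r_le_l : L.r ≤ L.l / 4 := L.r_le

theorem mem_inner_of_near {k t : ℝ} (hk : k ∈ L.K) (ht : |t - k| ≤ 4 * L.r) :
    t ∈ L.inner := by
  have h1 := L.K_bounds hk
  have h2 := L.r_le_l
  have h3 := L.W_eq
  have h4 := L.l_pos
  rw [abs_le] at ht
  constructor <;> linarith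

theorem K_subset_inner {k : ℝ} (hk : k ∈ L.K) : k ∈ L.inner :=
  L.mem_inner_of_near hk (by simp [L.r_pos.le])

theorem cut_nonempty : L.cut.Nonempty := Set.insert_nonempty _ _

theorem isCompact_cut : IsCompact L.cut := (L.K.finite_toSet.insert _).isCompact

theorem infDist_cut_le_W {t : ℝ} (ht : t ∈ L.inner) : Metric.infDist t L.cut ≤ L.W := by
  refine (Metric.infDist_le_dist_of_mem (Set.mem_insert _ _)).trans ?_
  rw [Real.dist_eq, abs_le]
  constructor <;> linarith [ht.1, ht.2, L.W_pos]

theorem rpow_bound {s : ℝ} (hs0 : 0 ≤ s) (hs : s ≤ 1 / L.N) :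
    L.C₁ * s ^ L.α ≤ L.C₁ * (1 / (L.N : ℝ)) ^ L.α :=
  mul_le_mul_of_nonneg_left (Real.rpow_le_rpow hs0 hs L.α_pos.le) L.C₁_pos.le

theorem W_le_inv : L.W ≤ 1 / L.N := by linarith [L.two_W_lt, L.W_pos]

theorem r_le_inv : L.r ≤ 1 / L.N := by
  linarith [L.W_le_inv, L.r_le_l, L.W_eq, L.l_pos, L.W_pos]

theorem rpow_net_nonneg : 0 ≤ L.C₁ * (1 / (L.N : ℝ)) ^ L.α :=
  mul_nonneg L.C₁_pos.le (Real.rpow_nonneg (one_div_pos.2 L.N_pos').le _)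

variable {L} {b t : ℝ}

theorem base_outer (ht : t ∈ L.outer) : L.base b t = L.F := by simp [base, ht]

theorem base_K (ht : t ∈ L.K) : L.base b t = L.γ / 2 := by
  have h := L.K_subset_inner ht
  simp [base, ht, h, L.notMem_outer h.2]

theorem base_inner (ht : t ∈ L.inner) (htK : t ∉ L.K) :
    L.base b t = L.γ + L.C₁ * Metric.infDist t L.cut ^ L.α := by
  simp [base, ht, htK, L.notMem_outer ht.2]

theorem base_low (ht : t ∈ L.low) : L.base b t = L.γ - L.C₁ * (L.ctr 0 - t) ^ L.α := by
  have h1 : t ∉ L.inner := fun h => ht.2.not_ge h.1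
  have h2 : t ∉ L.outer := L.notMem_outer (by linarith [ht.2, L.W_pos])
  simp [base, ht, h1, h2]

theorem base_off (h1 : t ∉ L.outer) (h2 : t ∉ L.inner) (h3 : t ∉ L.low) : L.base b t = b := by
  simp [base, h1, h2, h3]

theorem base_inner_ge (ht : t ∈ L.inner) (htK : t ∉ L.K) : L.γ ≤ L.base b t := by
  rw [base_inner ht htK]
  linarith [mul_nonneg L.C₁_pos.le
    (Real.rpow_nonneg (Metric.infDist_nonneg (x := t) (s := L.cut)) L.α)]

theorem base_inner_le (ht : t ∈ L.inner) (htK : t ∉ L.K) :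
    L.base b t ≤ L.γ + L.C₁ * (1 / (L.N : ℝ)) ^ L.α := by
  rw [base_inner ht htK]
  linarith [L.rpow_bound Metric.infDist_nonneg ((L.infDist_cut_le_W ht).trans L.W_le_inv)]

theorem base_low_ge (ht : t ∈ L.low) : L.γ / 2 ≤ L.base b t := by
  rw [base_low ht]
  have h1 := ht.1
  linarith [L.rpow_bound (s := L.ctr 0 - t) (by linarith [ht.2]) (by linarith [L.W_le_inv]), L.net,
    L.rpow_net_nonneg]

theorem base_low_lt (ht : t ∈ L.low) : L.base b t < L.γ := by
  rw [base_low ht]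
  have := mul_pos L.C₁_pos (Real.rpow_pos_of_pos (sub_pos.2 ht.2) L.α)
  linarith

theorem base_nonneg (hb : 0 ≤ b) : 0 ≤ L.base b t := by
  have hγ := L.γ_pos
  by_cases h1 : t ∈ L.outer
  · rw [base_outer h1]; exact L.F_pos.le
  by_cases h2 : t ∈ L.inner
  · by_cases h3 : t ∈ L.K
    · rw [base_K h3]; linarith
    · exact hγ.le.trans (base_inner_ge h2 h3)
  by_cases h4 : t ∈ L.low
  · linarith [base_low_ge (b := b) h4]
  · rwa [base_off h1 h2 h4]

theorem base_le (hb : b ≤ L.γ / 2) : L.base b t ≤ L.F := by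
  have hγ := L.γ_pos
  have hF := L.γ_lt
  by_cases h1 : t ∈ L.outer
  · rw [base_outer h1]
  by_cases h2 : t ∈ L.inner
  · by_cases h3 : t ∈ L.K
    · rw [base_K h3]; linarith
    · linarith [base_inner_le (b := b) h2 h3, L.net', L.rpow_net_nonneg]
  by_cases h4 : t ∈ L.low
  · linarith [base_low_lt (b := b) h4]
  · rw [base_off h1 h2 h4]; linarith

theorem le_base_iff (hb : b ≤ L.γ / 2) : L.γ ≤ L.base b t ↔ t ∈ L.good := by
  have hγ := L.γ_pos
  have hF := L.γ_lt
  by_cases h1 : t ∈ L.outer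
  · rw [base_outer h1]
    exact ⟨fun _ => Or.inl h1, fun _ => hF.le⟩
  by_cases h2 : t ∈ L.inner
  · by_cases h3 : t ∈ L.K
    · rw [base_K h3]
      constructor
      · intro h; linarith
      · rintro (h | h)
        · exact absurd h h1
        · exact absurd h3 h.2
    · exact ⟨fun _ => Or.inr ⟨h2, h3⟩, fun _ => base_inner_ge h2 h3⟩
  have hg : t ∉ L.good := by
    rintro (h | h)
    · exact h1 h
    · exact h2 h.1
  by_cases h4 : t ∈ L.low
  · exact ⟨fun h => absurd h (base_low_lt h4).not_ge, fun h => absurd h hg⟩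
  · rw [base_off h1 h2 h4]
    exact ⟨fun h => by linarith, fun h => absurd h hg⟩

variable (L)

theorem measurableSet_outer : MeasurableSet L.outer :=
  Finset.measurableSet_biUnion _ fun _ _ => measurableSet_Icc

theorem measurable_base (b : ℝ) : Measurable (L.base b) := by
  refine Measurable.ite L.measurableSet_outer measurable_const
    (Measurable.ite measurableSet_Icc (Measurable.ite L.K.measurableSet measurable_const ?_)
    (Measurable.ite measurableSet_Ico ?_ measurable_const))
  · have : Measurable fun t => Metric.infDist t L.cut := measurable_infDist
    fun_prop
  · fun_prop

theorem cubeVolume_outer {d : ℕ} (i : Fin d) :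
    (cubeVolume d).real {x | x.1 i ∈ L.outer} = (L.N - 1) * (2 * L.W) := by
  have hsub : L.outer ⊆ Set.Icc 0 1 := fun t ht => by
    obtain ⟨i, _, hi, h⟩ := L.mem_outer.1 ht
    exact L.mem_Icc_of_slab hi h
  rw [Measure.real, cubeVolume_coord_mem i L.measurableSet_outer, Set.inter_eq_left.2 hsub, outer,
    measure_biUnion_finset]
  · simp only [Real.volume_Icc]
    have : ∀ j ∈ Finset.Ico 1 L.N, ENNReal.ofReal (L.ctr j + L.W - (L.ctr j - L.W)) =
        ENNReal.ofReal (2 * L.W) := fun j _ => by congr 1; ring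
    rw [Finset.sum_congr rfl this, Finset.sum_const, Nat.card_Ico, nsmul_eq_mul, ENNReal.toReal_mul,
      ENNReal.toReal_ofReal (by linarith [L.W_pos]), ENNReal.toReal_natCast,
      Nat.cast_sub L.N_pos, Nat.cast_one]
  · intro i _ j _ hij
    rw [Function.onFun, Set.disjoint_left]
    intro t ht ht'
    rcases lt_or_gt_of_ne hij with h | h
    · linarith [L.gap h, ht.2, ht'.1]
    · linarith [L.gap h, ht.1, ht'.2]
  · exact fun _ _ => measurableSet_Icc

theorem cubeVolume_slabs {d : ℕ} (i : Fin d) :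
    (cubeVolume d).real {x | x.1 i ∈ L.outer ∪ Set.Icc (L.ctr 0 - L.W) (L.ctr 0 + L.W)} =
      1 / L.F := by
  have hunion : {x : UnitCube d | x.1 i ∈ L.outer ∪ Set.Icc (L.ctr 0 - L.W) (L.ctr 0 + L.W)} =
      {x | x.1 i ∈ L.outer} ∪ {x | x.1 i ∈ Set.Icc (L.ctr 0 - L.W) (L.ctr 0 + L.W)} := rfl
  rw [hunion, measureReal_union, cubeVolume_outer]
  · rw [Measure.real, cubeVolume_coord_mem i measurableSet_Icc,
      Set.inter_eq_left.2 fun t ht => L.mem_Icc_of_slab L.N_pos ht, Real.volume_Icc,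
      ENNReal.toReal_ofReal (by linarith [L.W_pos])]
    have := L.N_pos'
    have := L.F_pos
    unfold W
    field_simp
    ring
  · rw [Set.disjoint_left]
    intro x h1 h2
    exact L.notMem_outer h2.2 h1
  · exact measurable_coord i measurableSet_Icc

theorem integrable_base {d : ℕ} (i : Fin d) {b : ℝ} (hb0 : 0 ≤ b) (hb : b ≤ L.γ / 2) :
    Integrable (fun x : UnitCube d => L.base b (x.1 i)) (cubeVolume d) :=
  .of_bound ((L.measurable_base b).comp (measurable_coord i)).aestronglyMeasurable L.F
    (.of_forall fun x => by
      rw [Real.norm_of_nonneg (base_nonneg hb0)]; exact base_le hb)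

/-- The value off the slabs can be chosen so that the total mass is one. -/
theorem exists_integral_base_eq_one {d : ℕ} (i : Fin d) :
    ∃ b, 0 ≤ b ∧ b ≤ L.γ / 2 ∧ ∫ x : UnitCube d, L.base b (x.1 i) ∂(cubeVolume d) = 1 := by
  classical
  have hγ := L.γ_pos
  have hF := L.F_pos
  have hF1 : 0 < 1 - 1 / L.F := by
    rw [sub_pos, div_lt_one hF]; exact L.one_lt
  set S : Set (UnitCube d) := {x | x.1 i ∈ L.outer ∪ Set.Icc (L.ctr 0 - L.W) (L.ctr 0 + L.W)}
  have hS : MeasurableSet S := measurable_coord i (L.measurableSet_outer.union measurableSet_Icc)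
  have hO : MeasurableSet {x : UnitCube d | x.1 i ∈ L.outer} :=
    measurable_coord i L.measurableSet_outer
  set I := ∫ x : UnitCube d, L.base 0 (x.1 i) ∂(cubeVolume d) with hI
  have hint := L.integrable_base i le_rfl (half_pos hγ).le
  -- The value `b` is taken exactly off the slabs, so the integral is affine in `b` with slope `1 -
  -- 1 / F`.
  have hsplit : ∀ b x, L.base b (x.1 i) = L.base 0 (x.1 i) + Sᶜ.indicator (fun _ => b) x := by
    intro b x
    have hmem : x ∈ S ↔ x.1 i ∈ L.outer ∨ x.1 i ∈ Set.Icc (L.ctr 0 - L.W) (L.ctr 0 + L.W) :=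
      Iff.rfl
    by_cases h1 : x.1 i ∈ L.outer
    · rw [Set.indicator_of_notMem (not_not.2 (hmem.2 (Or.inl h1)) : x ∉ Sᶜ), base_outer h1, base_outer h1,
        add_zero]
    by_cases h2 : x.1 i ∈ L.inner
    · rw [Set.indicator_of_notMem
        (not_not.2 (hmem.2 (Or.inr ⟨by linarith [h2.1, L.W_pos], h2.2⟩)) : x ∉ Sᶜ)]
      by_cases h3 : x.1 i ∈ L.K
      · rw [base_K h3, base_K h3, add_zero]
      · rw [base_inner h2 h3, base_inner h2 h3, add_zero]
    by_cases h4 : x.1 i ∈ L.low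
    · rw [Set.indicator_of_notMem
        (not_not.2 (hmem.2 (Or.inr ⟨h4.1, by linarith [h4.2, L.W_pos]⟩)) : x ∉ Sᶜ), base_low h4,
        base_low h4, add_zero]
    · rw [base_off h1 h2 h4, base_off h1 h2 h4, Set.indicator_of_mem, zero_add]
      intro h
      rcases hmem.1 h with h | h
      · exact h1 h
      · obtain h5 | h5 := le_or_gt (L.ctr 0) (x.1 i)
        · exact h2 ⟨h5, h.2⟩
        · exact h4 ⟨h.1, h5⟩
  -- The slabs have total volume `1 / F` and the profile is at most `F`, so `b` comes out
  -- nonnegative.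
  have hub : I ≤ 1 := by
    have h1 : ∀ x : UnitCube d, L.base 0 (x.1 i) ≤ S.indicator (fun _ => L.F) x := by
      intro x
      by_cases hx : x ∈ S
      · rw [Set.indicator_of_mem hx]; exact base_le (half_pos hγ).le
      · rw [Set.indicator_of_notMem hx, base_off]
        · exact fun h => hx (Or.inl h)
        · exact fun h => hx (Or.inr ⟨by linarith [h.1, L.W_pos], h.2⟩)
        · exact fun h => hx (Or.inr ⟨h.1, by linarith [h.2, L.W_pos]⟩)
    refine (integral_mono hint ((integrable_const _).indicator hS) h1).trans ?_
    rw [integral_indicator_const _ hS, L.cubeVolume_slabs i, smul_eq_mul]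
    exact (one_div_mul_cancel hF.ne').le
  -- The outer slabs alone carry mass `1 - 1 / N`. The missing mass is at most `1 / N`, and `L.mass`
  -- turns this into `b ≤ γ / 2`.
  have hlb : 1 - 1 / (L.N : ℝ) ≤ I := by
    have h1 : ∀ x : UnitCube d, {x : UnitCube d | x.1 i ∈ L.outer}.indicator (fun _ => L.F) x ≤
        L.base 0 (x.1 i) := by
      intro x
      by_cases hx : x.1 i ∈ L.outer
      · rw [Set.indicator_of_mem (by exact hx), base_outer hx]
      · rw [Set.indicator_of_notMem (by exact hx)]; exact base_nonneg le_rfl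
    refine le_trans ?_ (integral_mono ((integrable_const _).indicator hO) hint h1)
    rw [integral_indicator_const _ hO, L.cubeVolume_outer i, smul_eq_mul]
    have := L.N_pos'
    refine le_of_eq ?_
    unfold W
    field_simp
  refine ⟨(1 - I) / (1 - 1 / L.F), div_nonneg (by linarith) hF1.le, ?_, ?_⟩
  · rw [div_le_iff₀ hF1]
    linarith [L.mass]
  · rw [integral_congr_ae (.of_forall fun x => hsplit _ x), integral_add hint ((integrable_const _).indicator hS.compl),
      integral_indicator_const _ hS.compl, probReal_compl_eq_one_sub hS, L.cubeVolume_slabs i,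
      smul_eq_mul, mul_div_cancel₀ _ hF1.ne', ← hI]
    ring

end Layout

/-! ### Abstract bumps and the perturbed density. -/

namespace Layout

variable (L : Layout)

/-- Slope of the bumps. -/
noncomputable def slope : ℝ := L.lam / 24

/-- Height of the bumps. -/
noncomputable def height : ℝ := L.slope * L.r

/-- Size of the perturbation of the density on a bump. -/
noncomputable def ampl : ℝ := 2 * (L.C₁ * L.r ^ L.α)

theorem slope_pos : 0 < L.slope := div_pos L.lam_pos (by norm_num)

theorem height_pos : 0 < L.height := mul_pos L.slope_pos L.r_pos

theorem height_le : 24 * L.height ≤ L.r := by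
  have : 24 * L.height = L.lam * L.r := by unfold height slope; ring
  rw [this]
  exact mul_le_of_le_one_left L.r_pos.le L.lam_le

theorem rpow_r_le : L.C₁ * L.r ^ L.α ≤ L.C₁ * (1 / (L.N : ℝ)) ^ L.α :=
  L.rpow_bound L.r_pos.le L.r_le_inv

theorem rpow_r_pos : 0 < L.C₁ * L.r ^ L.α := mul_pos L.C₁_pos (Real.rpow_pos_of_pos L.r_pos _)

theorem ampl_pos : 0 < L.ampl := mul_pos two_pos L.rpow_r_pos

theorem ampl_le : L.ampl ≤ L.γ / 2 := by
  unfold ampl; linarith [L.rpow_r_le, L.net, L.rpow_r_pos]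

/-- A pair of sets near the point `k` of `K` between which mass is moved. -/
structure IsBump {d : ℕ} (i : Fin d) (H R : Set (UnitCube d)) (k : ℝ) : Prop where
  mem_K : k ∈ L.K
  meas_H : MeasurableSet H
  meas_R : MeasurableSet R
  volume_eq : (cubeVolume d).real R = (cubeVolume d).real H
  near_H : ∀ x ∈ H, |x.1 i - k| < L.height
  near_R : ∀ x ∈ R, L.height < |x.1 i - k| ∧ |x.1 i - k| ≤ 3 * L.height
  -- Cone condition: from a point outside the hole, every point lying further from the slice within
  -- a cone of slope `slope` is outside as well.
  up : ∀ x ∉ H, ∀ z : UnitCube d, k ≤ x.1 i → L.slope * dist x z ≤ z.1 i - x.1 i → z ∉ H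
  down : ∀ x ∉ H, ∀ z : UnitCube d, x.1 i ≤ k → L.slope * dist x z ≤ x.1 i - z.1 i → z ∉ H

/-- The unperturbed density is the case of empty sets, so one verification of the regularity
conditions serves all hypotheses. -/
theorem isBump_empty {d : ℕ} (i : Fin d) {k : ℝ} (hk : k ∈ L.K) : L.IsBump i ∅ ∅ k where
  mem_K := hk
  meas_H := .empty
  meas_R := .empty
  volume_eq := rfl
  near_H := fun _ h => h.elim
  near_R := fun _ h => h.elim
  up := fun _ _ _ _ _ h => h
  down := fun _ _ _ _ _ h => h

/-- The density with base value `b`, lowered on `H` and raised on `R`. -/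
noncomputable def density {d : ℕ} (b : ℝ) (i : Fin d) (H R : Set (UnitCube d)) (x : UnitCube d) :
    ℝ :=
  L.base b (x.1 i) + L.ampl * (R.indicator (fun _ => 1) x - H.indicator (fun _ => 1) x)

/-- The level set of `density`. -/
def superlevel {d : ℕ} (i : Fin d) (H : Set (UnitCube d)) : Set (UnitCube d) :=
  {x | x.1 i ∈ L.good ∧ x ∉ H}

variable {L} {d : ℕ} {i : Fin d} {H R : Set (UnitCube d)} {k b : ℝ}

theorem notMem_K_of_near (hk : k ∈ L.K) {t : ℝ} (ht : |t - k| ≤ L.r) (htk : t ≠ k) : t ∉ L.K := by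
  intro h
  have := L.sep t h k hk htk
  linarith [L.r_pos]

theorem le_abs_sub_of_near (hk : k ∈ L.K) {k' : ℝ} (hk' : k' ∈ L.K) (hne : k' ≠ k) {t : ℝ}
    (ht : |t - k| ≤ L.r) : L.r ≤ |t - k'| := by
  have := L.sep k' hk' k hk hne
  have h2 := abs_sub_le k' t k
  rw [abs_sub_comm k' t] at h2
  linarith [L.r_pos]

theorem infDist_cut_le_of_near (hk : k ∈ L.K) (t : ℝ) : Metric.infDist t L.cut ≤ |t - k| :=
  Metric.infDist_le_dist_of_mem (Set.mem_insert_of_mem _ hk)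

namespace IsBump

theorem mem_inner_of_mem_H (hB : L.IsBump i H R k) {x : UnitCube d} (hx : x ∈ H) : x.1 i ∈ L.inner :=
  L.mem_inner_of_near hB.mem_K (by linarith [hB.near_H x hx, L.height_le, L.r_pos, L.height_pos])

theorem mem_inner_of_mem_R (hB : L.IsBump i H R k) {x : UnitCube d} (hx : x ∈ R) : x.1 i ∈ L.inner :=
  L.mem_inner_of_near hB.mem_K
    (by linarith [(hB.near_R x hx).2, L.height_le, L.r_pos, L.height_pos])

theorem notMem_K_of_mem_R (hB : L.IsBump i H R k) {x : UnitCube d} (hx : x ∈ R) : x.1 i ∉ L.K := by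
  have h := hB.near_R x hx
  refine notMem_K_of_near hB.mem_K (by linarith [L.height_le, L.height_pos]) fun h' => ?_
  rw [h', sub_self, abs_zero] at h
  linarith [L.height_pos]

theorem notMem_R_of_mem_H (hB : L.IsBump i H R k) {x : UnitCube d} (hx : x ∈ H) : x ∉ R := fun h =>
  (hB.near_H x hx).not_gt (hB.near_R x h).1

theorem base_H_le (hB : L.IsBump i H R k) {x : UnitCube d} (hx : x ∈ H) :
    L.base b (x.1 i) ≤ L.γ + L.C₁ * L.r ^ L.α := by
  by_cases h : x.1 i ∈ L.K
  · rw [base_K h]; linarith [L.γ_pos, L.rpow_r_pos]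
  · rw [base_inner (hB.mem_inner_of_mem_H hx) h]
    have h1 : Metric.infDist (x.1 i) L.cut ≤ L.r := by
      linarith [infDist_cut_le_of_near hB.mem_K (x.1 i), hB.near_H x hx, L.height_le, L.height_pos]
    have := mul_le_mul_of_nonneg_left (Real.rpow_le_rpow Metric.infDist_nonneg h1 L.α_pos.le)
      L.C₁_pos.le
    linarith

theorem base_H_ge (hB : L.IsBump i H R k) {x : UnitCube d} (hx : x ∈ H) :
    L.γ / 2 ≤ L.base b (x.1 i) := by
  by_cases h : x.1 i ∈ L.K
  · rw [base_K h]
  · linarith [base_inner_ge (b := b) (hB.mem_inner_of_mem_H hx) h, L.γ_pos]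

theorem base_R_le (hB : L.IsBump i H R k) {x : UnitCube d} (hx : x ∈ R) :
    L.base b (x.1 i) ≤ L.γ + L.C₁ * L.r ^ L.α := by
  rw [base_inner (hB.mem_inner_of_mem_R hx) (hB.notMem_K_of_mem_R hx)]
  have h1 : Metric.infDist (x.1 i) L.cut ≤ L.r := by
    linarith [infDist_cut_le_of_near hB.mem_K (x.1 i), (hB.near_R x hx).2, L.height_le,
      L.height_pos]
  have := mul_le_mul_of_nonneg_left (Real.rpow_le_rpow Metric.infDist_nonneg h1 L.α_pos.le)
    L.C₁_pos.le
  linarith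

theorem base_R_ge (hB : L.IsBump i H R k) {x : UnitCube d} (hx : x ∈ R) : L.γ ≤ L.base b (x.1 i) :=
  base_inner_ge (hB.mem_inner_of_mem_R hx) (hB.notMem_K_of_mem_R hx)

theorem density_H (hB : L.IsBump i H R k) {x : UnitCube d} (hx : x ∈ H) :
    L.density b i H R x = L.base b (x.1 i) - L.ampl := by
  simp [density, hx, hB.notMem_R_of_mem_H hx, sub_eq_add_neg]

end IsBump

theorem density_R {x : UnitCube d} (hxH : x ∉ H) (hx : x ∈ R) :
    L.density b i H R x = L.base b (x.1 i) + L.ampl := by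
  simp [density, hx, hxH]

end Layout

/-! ### Level set and lower regularity of the perturbed density. -/

namespace Layout
variable {L : Layout} {d : ℕ} {i : Fin d} {H R : Set (UnitCube d)} {k b : ℝ}

theorem density_off {x : UnitCube d} (hxH : x ∉ H) (hx : x ∉ R) :
    L.density b i H R x = L.base b (x.1 i) := by
  simp [density, hx, hxH]

theorem base_le_density {x : UnitCube d} (hxH : x ∉ H) :
    L.base b (x.1 i) ≤ L.density b i H R x := by
  by_cases hx : x ∈ R
  · rw [density_R hxH hx]; linarith [L.ampl_pos]
  · rw [density_off hxH hx]

namespace IsBump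

/-- On the hole the profile is at most `γ + C₁ * r ^ α`. The factor `2` in `ampl` both pushes it
below `γ` and leaves the margin `C₁ * r ^ α` that lower regularity needs at distance `r` from the
boundary. -/
theorem density_H_le (hB : L.IsBump i H R k) {x : UnitCube d} (hx : x ∈ H) :
    L.density b i H R x ≤ L.γ - L.C₁ * L.r ^ L.α := by
  rw [hB.density_H hx]
  have := hB.base_H_le (b := b) hx
  unfold ampl
  linarith

theorem levelSet_density (hB : L.IsBump i H R k) (hb : b ≤ L.γ / 2) :
    levelSet (L.density b i H R) L.γ = L.superlevel i H := by
  ext x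
  change L.γ ≤ L.density b i H R x ↔ x.1 i ∈ L.good ∧ x ∉ H
  by_cases hxH : x ∈ H
  · have := hB.density_H_le (b := b) hxH
    exact ⟨fun h => by linarith [L.rpow_r_pos], fun h => absurd hxH h.2⟩
  · by_cases hxR : x ∈ R
    · exact ⟨fun _ => ⟨Or.inr ⟨hB.mem_inner_of_mem_R hxR, hB.notMem_K_of_mem_R hxR⟩, hxH⟩,
        fun _ => (hB.base_R_ge hxR).trans (base_le_density hxH)⟩
    · rw [density_off hxH hxR, le_base_iff hb]
      exact ⟨fun h => ⟨h, hxH⟩, fun h => h.1⟩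

theorem measurable_density (hB : L.IsBump i H R k) : Measurable (L.density b i H R) := by
  have h1 := (L.measurable_base b).comp (measurable_coord i)
  exact h1.add (((measurable_const.indicator hB.meas_R).sub
    (measurable_const.indicator hB.meas_H)).const_mul _)

theorem density_nonneg (hB : L.IsBump i H R k) (hb : 0 ≤ b) (x : UnitCube d) :
    0 ≤ L.density b i H R x := by
  by_cases hxH : x ∈ H
  · rw [hB.density_H hxH]
    linarith [hB.base_H_ge (b := b) hxH, L.ampl_le]
  · exact (base_nonneg hb).trans (base_le_density hxH)

theorem density_le (hB : L.IsBump i H R k) (hb : b ≤ L.γ / 2) (x : UnitCube d) :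
    L.density b i H R x ≤ L.F := by
  by_cases hxH : x ∈ H
  · linarith [hB.density_H_le (b := b) hxH, L.rpow_r_pos, L.γ_lt]
  · by_cases hxR : x ∈ R
    · rw [density_R hxH hxR]
      have := hB.base_R_le (b := b) hxR
      have h2 := L.net'
      have h3 := L.rpow_r_le
      unfold ampl
      linarith
    · rw [density_off hxH hxR]
      exact base_le hb

theorem isBoundedDensity (hB : L.IsBump i H R k) (hb0 : 0 ≤ b) (hb : b ≤ L.γ / 2)
    (hb1 : ∫ x : UnitCube d, L.base b (x.1 i) ∂(cubeVolume d) = 1) :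
    IsBoundedDensity L.F (L.density b i H R) where
  measurable := hB.measurable_density
  nonneg := hB.density_nonneg hb0
  le_max := hB.density_le hb
  lintegral_eq_one := by
    have hR : Integrable (R.indicator fun _ => (1 : ℝ)) (cubeVolume d) :=
      (integrable_const _).indicator hB.meas_R
    have hH : Integrable (H.indicator fun _ => (1 : ℝ)) (cubeVolume d) :=
      (integrable_const _).indicator hB.meas_H
    have hbase := L.integrable_base i hb0 hb
    have hRH : Integrable (fun x => L.ampl * (R.indicator (fun _ => (1 : ℝ)) x -
        H.indicator (fun _ => 1) x)) (cubeVolume d) := (hR.sub hH).const_mul _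
    have hint : Integrable (L.density b i H R) (cubeVolume d) := hbase.add hRH
    have h1 : ∫ x, L.density b i H R x ∂(cubeVolume d) = 1 := by
      unfold density
      rw [integral_add hbase hRH, hb1, integral_const_mul,
        integral_sub hR hH, integral_indicator_const _ hB.meas_R,
        integral_indicator_const _ hB.meas_H, hB.volume_eq]
      simp
    rw [← ofReal_integral_eq_lintegral_ofReal hint (.of_forall (hB.density_nonneg hb0)), h1,
      ENNReal.ofReal_one]

end IsBump

/-! Points of the level set and its complement near a given point. -/

theorem exists_cell {t : ℝ} (ht : t ∈ Set.Icc (0 : ℝ) 1) :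
    ∃ j < L.N, (j : ℝ) * (1 / L.N) ≤ t ∧ t ≤ (j + 1) * (1 / L.N) := by
  have hN := L.N_pos'
  have key : ∀ j : ℕ, (j : ℝ) ≤ t * L.N → t * L.N ≤ j + 1 →
      (j : ℝ) * (1 / L.N) ≤ t ∧ t ≤ (j + 1) * (1 / L.N) := fun j h1 h2 =>
    ⟨by rwa [mul_one_div, div_le_iff₀ hN], by rwa [mul_one_div, le_div_iff₀ hN]⟩
  obtain h1 | h1 := ht.2.lt_or_eq
  · refine ⟨⌊t * L.N⌋₊, ?_, key _ (Nat.floor_le (mul_nonneg ht.1 hN.le))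
      (Nat.lt_floor_add_one _).le⟩
    rw [Nat.floor_lt (mul_nonneg ht.1 hN.le)]
    exact mul_lt_of_lt_one_left hN h1
  -- The right endpoint `t = 1` belongs to the last cell; the floor would give the index `N`.
  · have h2 : ((L.N - 1 : ℕ) : ℝ) = L.N - 1 := by rw [Nat.cast_sub L.N_pos, Nat.cast_one]
    refine ⟨L.N - 1, Nat.sub_lt L.N_pos one_pos, key _ ?_ ?_⟩ <;> rw [h2, h1] <;> linarith

/-- Multiples of `1 / N` lie midway between consecutive slab centres, and `2 * W < 1 / N`. -/
theorem notMem_good_grid (j : ℕ) : (j : ℝ) * (1 / L.N) ∉ L.good := by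
  have hN := one_div_pos.2 L.N_pos'
  have hslab : ∀ n : ℕ, (j : ℝ) * (1 / L.N) ∉ Set.Icc (L.ctr n - L.W) (L.ctr n + L.W) := by
    rintro n ⟨h1, h2⟩
    rw [L.ctr_eq] at h1 h2
    have h3 := L.W_lt_ctr
    have h4 := L.two_ctr_zero
    rcases lt_or_ge n j with h | h
    · have h5 : ((n : ℝ) + 1) ≤ j := by exact_mod_cast h
      linarith [mul_le_mul_of_nonneg_right h5 hN.le]
    · have h5 : (j : ℝ) ≤ n := by exact_mod_cast h
      linarith [mul_le_mul_of_nonneg_right h5 hN.le]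
  rintro (h | h)
  · obtain ⟨n, _, _, h⟩ := L.mem_outer.1 h
    exact hslab n h
  · exact hslab 0 ⟨by linarith [h.1.1, L.W_pos], h.1.2⟩

theorem exists_notMem_good_near {t : ℝ} (ht : t ∈ Set.Icc (0 : ℝ) 1) :
    ∃ s ∈ Set.Icc (0 : ℝ) 1, s ∉ L.good ∧ |t - s| ≤ 1 / L.N := by
  obtain ⟨j, _, h1, h2⟩ := L.exists_cell ht
  have hN := one_div_pos.2 L.N_pos'
  refine ⟨j * (1 / L.N), ⟨by positivity, h1.trans ht.2⟩, L.notMem_good_grid j, ?_⟩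
  rw [abs_le]
  constructor <;> linarith

theorem far_of_ge {t : ℝ} (ht : L.ctr 0 + 4 * L.l ≤ t) (hk : k ∈ L.K) : L.l ≤ |t - k| :=
  le_trans (by linarith [(L.K_bounds hk).2]) (le_abs_self _)

theorem far_of_le {t : ℝ} (ht : t ≤ L.ctr 0 + L.l / 2) (hk : k ∈ L.K) : L.l / 2 ≤ |t - k| := by
  rw [abs_sub_comm]
  exact le_trans (by linarith [(L.K_bounds hk).1]) (le_abs_self _)

theorem notMem_K_of_forall {t c : ℝ} (hc : 0 < c) (h : ∀ k ∈ L.K, c ≤ |t - k|) : t ∉ L.K := by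
  intro ht
  have := h t ht
  rw [sub_self, abs_zero] at this
  linarith

theorem height_le_l : 90 * L.height ≤ L.l := by
  linarith [L.height_le, L.r_le_l, L.height_pos]

theorem IsBump.mem_superlevel (hB : L.IsBump i H R k) {x : UnitCube d}
    (hx : x.1 i ∈ L.outer ∪ L.inner) (hfar : ∀ k ∈ L.K, L.height ≤ |x.1 i - k|) :
    x ∈ L.superlevel i H := by
  refine ⟨?_, fun h => (hB.near_H x h).not_ge (hfar k hB.mem_K)⟩
  rcases hx with h | h
  · exact Or.inl h
  · exact Or.inr ⟨h, notMem_K_of_forall L.height_pos hfar⟩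

theorem IsBump.mem_superlevel_of_outer (hB : L.IsBump i H R k) {x : UnitCube d}
    (hx : x.1 i ∈ L.outer) : x ∈ L.superlevel i H := by
  refine hB.mem_superlevel (Or.inl hx) fun k hk => ?_
  have := far_of_ge (t := x.1 i) (by linarith [L.lt_of_mem_outer hx, L.W_eq, L.l_pos]) hk
  linarith [L.height_le_l, L.height_pos]

theorem IsBump.exists_mem_superlevel_near (hB : L.IsBump i H R k) (x : UnitCube d) :
    ∃ w ∈ L.superlevel i H, dist x w ≤ 1 / L.N := by
  obtain ⟨j, hj, h1, h2⟩ := L.exists_cell (x.2 i)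
  have hW := L.W_pos
  have hmem : L.ctr j + L.W ∈ Set.Icc (L.ctr j - L.W) (L.ctr j + L.W) := ⟨by linarith, le_rfl⟩
  refine ⟨moveCoord i x _ (L.mem_Icc_of_slab hj hmem), hB.mem_superlevel ?_ fun k hk => ?_, ?_⟩
  · rw [moveCoord_apply_self]
    rcases Nat.eq_zero_or_pos j with rfl | hj0
    · exact Or.inr ⟨by linarith, le_rfl⟩
    · exact Or.inl (L.mem_outer.2 ⟨j, hj0, hj, hmem⟩)
  · rw [moveCoord_apply_self]
    have : L.ctr 0 ≤ L.ctr j := by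
      rw [L.ctr_eq j]
      have := one_div_pos.2 L.N_pos'
      have : 0 ≤ (j : ℝ) * (1 / L.N) := by positivity
      linarith
    have := far_of_ge (t := L.ctr j + L.W) (by linarith [L.W_eq, L.l_pos]) hk
    linarith [L.height_le_l, L.height_pos]
  · rw [dist_moveCoord, L.ctr_eq, abs_le]
    have := L.two_ctr_zero
    have := L.W_lt_ctr
    constructor <;> linarith

theorem nonempty_frontier {G : Set (UnitCube d)} {x w : UnitCube d} (hx : x ∈ G) (hw : w ∉ G) :
    (frontier G).Nonempty := by
  obtain ⟨z, hz, _⟩ := exists_frontier_dist_le hx hw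
  exact ⟨z, hz⟩

theorem IsBump.frontier_nonempty (hB : L.IsBump i H R k) :
    (frontier (L.superlevel i H)).Nonempty := by
  let x₀ : UnitCube d := ⟨0, fun _ => by simp⟩
  obtain ⟨w, hw, _⟩ := hB.exists_mem_superlevel_near x₀
  refine nonempty_frontier hw (w := x₀) fun h => ?_
  have := L.notMem_good_grid 0
  rw [Nat.cast_zero, zero_mul] at this
  exact this h.1

theorem mul_rpow_le {ρ c y : ℝ} (hρ : 0 ≤ ρ) (h : ρ ≤ c) (hy : L.C₁ * c ^ L.α ≤ y) :
    L.C₁ * ρ ^ L.α ≤ y :=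
  (mul_le_mul_of_nonneg_left (Real.rpow_le_rpow hρ h L.α_pos.le) L.C₁_pos.le).trans hy

/-- In each region the distance to the boundary is bounded by exhibiting a point on the other side.
Where the density is at most `γ / 2` or at least `F`, the bound `1 / N` and the constraints `net`,
`net'` suffice; in the hole it is `r`; in the rest of the first slab the profile has the required
power form. -/
theorem IsBump.lowerRegular (hB : L.IsBump i H R k) (hb : b ≤ L.γ / 2) (δ : ℝ) :
    LowerRegular L.α L.γ L.C₁ δ (L.density b i H R) := by
  intro x _
  rw [hB.levelSet_density hb]
  refine ⟨hB.frontier_nonempty, ?_⟩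
  set ρ := Metric.infDist x (frontier (L.superlevel i H))
  have hρ : 0 ≤ ρ := Metric.infDist_nonneg
  have hnet0 := L.rpow_net_nonneg
  have hlow : ∀ hx : x ∉ L.superlevel i H, L.density b i H R x ≤ L.γ / 2 →
      L.C₁ * ρ ^ L.α ≤ |L.density b i H R x - L.γ| := by
    intro hx hf
    obtain ⟨w, hw, hd⟩ := hB.exists_mem_superlevel_near x
    refine mul_rpow_le hρ ((infDist_frontier_le_of_notMem hx hw).trans hd) ?_
    rw [abs_sub_comm]
    refine le_trans ?_ (le_abs_self _)
    linarith [L.net]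
  by_cases hxH : x ∈ H
  -- Sliding `x` to coordinate `k + height` leaves the hole and stays off `K`, at a cost of at most
  -- `2 * height ≤ r`.
  · have hs : k + L.height ∈ L.inner := L.mem_inner_of_near hB.mem_K (by
      rw [add_sub_cancel_left, abs_of_pos L.height_pos]
      linarith [L.height_le, L.r_pos, L.height_pos])
    have hsI := L.mem_Icc_of_slab L.N_pos (t := k + L.height)
      ⟨by linarith [hs.1, L.W_pos], hs.2⟩
    have hw : moveCoord i x _ hsI ∈ L.superlevel i H := by
      refine ⟨?_, fun h => ?_⟩
      · rw [moveCoord_apply_self]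
        refine Or.inr ⟨hs, notMem_K_of_near hB.mem_K ?_ ?_⟩
        · rw [add_sub_cancel_left, abs_of_pos L.height_pos]
          linarith [L.height_le, L.height_pos]
        · linarith [L.height_pos]
      · have := hB.near_H _ h
        rw [moveCoord_apply_self, add_sub_cancel_left, abs_of_pos L.height_pos] at this
        exact lt_irrefl _ this
    have h1 := infDist_frontier_le_of_notMem (G := L.superlevel i H) (fun h => h.2 hxH) hw
    rw [dist_moveCoord] at h1
    refine mul_rpow_le hρ (c := L.r) (h1.trans ?_) ?_
    · have h2 := abs_lt.1 (hB.near_H x hxH)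
      rw [abs_le]
      constructor <;> linarith [L.height_le, L.height_pos]
    · rw [abs_sub_comm]
      refine le_trans ?_ (le_abs_self _)
      linarith [hB.density_H_le (b := b) hxH]
  by_cases hgood : x.1 i ∈ L.good
  · have hx : x ∈ L.superlevel i H := ⟨hgood, hxH⟩
    have hf : L.base b (x.1 i) ≤ L.density b i H R x := base_le_density hxH
    refine le_trans ?_ (le_abs_self _)
    rcases hgood with h | ⟨h, hK⟩
    · rw [base_outer h] at hf
      obtain ⟨s, hs, hsg, hd⟩ := L.exists_notMem_good_near (x.2 i)
      have h1 := infDist_frontier_le_of_mem (G := L.superlevel i H) (w := moveCoord i x s hs) hx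
        (fun h => hsg (by simpa using h.1))
      rw [dist_moveCoord] at h1
      refine mul_rpow_le hρ (h1.trans hd) ?_
      linarith [L.net']
    · rw [base_inner h hK] at hf
      refine mul_rpow_le hρ (c := Metric.infDist (x.1 i) L.cut) ?_ (by linarith)
      obtain ⟨p, hp, hpd⟩ := L.isCompact_cut.exists_infDist_eq_dist L.cut_nonempty (x.1 i)
      rw [hpd, Real.dist_eq]
      -- The slice over `ctr 0` belongs to the level set, so the complement is reached only in the
      -- limit from `low`; the slices over `K` are themselves in the complement.
      rcases hp with rfl | hp
      · refine le_of_forall_pos_le_add fun σ hσ => ?_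
        set s := L.ctr 0 - min σ L.W
        have hs : s ∈ L.low := ⟨by simp only [s]; linarith [min_le_right σ L.W],
          by simp only [s]; linarith [lt_min hσ L.W_pos]⟩
        have hsI := L.mem_Icc_of_slab L.N_pos (t := s) ⟨hs.1, by linarith [hs.2, L.W_pos]⟩
        have h1 := infDist_frontier_le_of_mem (G := L.superlevel i H) (w := moveCoord i x s hsI) hx
          (fun h => by
            have h2 := h.1
            rw [moveCoord_apply_self, ← le_base_iff hb] at h2
            exact h2.not_gt (base_low_lt hs))
        rw [dist_moveCoord] at h1
        refine h1.trans ((abs_sub_le _ (L.ctr 0) _).trans ?_)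
        have h3 : |L.ctr 0 - s| ≤ σ := by
          simp only [s, sub_sub_cancel]
          rw [abs_of_pos (lt_min hσ L.W_pos)]
          exact min_le_left _ _
        linarith
      · have hpi := L.K_subset_inner hp
        have hpI := L.mem_Icc_of_slab L.N_pos (t := p) ⟨by linarith [hpi.1, L.W_pos], hpi.2⟩
        have h1 := infDist_frontier_le_of_mem (G := L.superlevel i H) (w := moveCoord i x p hpI) hx
          (fun h => by
            have h2 := h.1
            rw [moveCoord_apply_self] at h2
            rcases h2 with h2 | h2
            · exact L.notMem_outer hpi.2 h2
            · exact h2.2 hp)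
        rwa [dist_moveCoord] at h1
  · have hx : x ∉ L.superlevel i H := fun h => hgood h.1
    have hxR : x ∉ R := fun h =>
      hgood (Or.inr ⟨hB.mem_inner_of_mem_R h, hB.notMem_K_of_mem_R h⟩)
    have hf : L.density b i H R x = L.base b (x.1 i) := density_off hxH hxR
    have ho : x.1 i ∉ L.outer := fun h => hgood (Or.inl h)
    by_cases hin : x.1 i ∈ L.inner
    · have hK : x.1 i ∈ L.K := by
        by_contra hK
        exact hgood (Or.inr ⟨hin, hK⟩)
      exact hlow hx (by rw [hf, base_K hK])
    by_cases hl : x.1 i ∈ L.low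
    · have hc : L.ctr 0 ∈ L.inner := ⟨le_rfl, by linarith [L.W_pos]⟩
      have hcI := L.mem_Icc_of_slab L.N_pos (t := L.ctr 0) ⟨by linarith [L.W_pos], hc.2⟩
      have hw : moveCoord i x _ hcI ∈ L.superlevel i H := by
        refine hB.mem_superlevel ?_ fun k hk => ?_
        · rw [moveCoord_apply_self]; exact Or.inr hc
        · rw [moveCoord_apply_self]
          linarith [far_of_le (t := L.ctr 0) (by linarith [L.l_pos]) hk, L.height_le_l,
            L.height_pos]
      have h1 := infDist_frontier_le_of_notMem hx hw
      rw [dist_moveCoord, abs_sub_comm, abs_of_pos (_root_.sub_pos.2 hl.2)] at h1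
      refine mul_rpow_le hρ h1 ?_
      rw [hf, base_low hl, abs_sub_comm]
      refine le_trans ?_ (le_abs_self _)
      linarith
    · exact hlow hx (by rw [hf, base_off ho hin hl]; exact hb)

end Layout

/-! ### Upper regularity and level set regularity. -/

namespace Layout
variable {L : Layout} {d : ℕ} {i : Fin d} {H R : Set (UnitCube d)} {k b : ℝ}

theorem continuous_coord (i : Fin d) : Continuous fun x : UnitCube d => x.1 i := by
  have : Continuous fun x : EuclideanSpace ℝ (Fin d) => x i := by fun_prop
  exact this.comp continuous_subtype_val

theorem ctr_mem_inner : L.ctr 0 ∈ L.inner := ⟨le_rfl, by linarith [L.W_pos]⟩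

theorem mem_Icc_of_inner {t : ℝ} (ht : t ∈ L.inner) : t ∈ Set.Icc (0 : ℝ) 1 :=
  L.mem_Icc_of_slab L.N_pos ⟨by linarith [ht.1, L.W_pos], ht.2⟩

theorem mem_Icc_of_low {t : ℝ} (ht : t ∈ L.low) : t ∈ Set.Icc (0 : ℝ) 1 :=
  L.mem_Icc_of_slab L.N_pos ⟨ht.1, by linarith [ht.2, L.W_pos]⟩

theorem notMem_good_of_low {t : ℝ} (ht : t ∈ L.low) : t ∉ L.good := by
  rintro (h | h)
  · exact L.notMem_outer (by linarith [ht.2, L.W_pos]) h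
  · exact ht.2.not_ge h.1.1

/-- Points just to the right of the first centre belong to the level set. -/
theorem IsBump.mem_superlevel_right (hB : L.IsBump i H R k) {x : UnitCube d}
    (h1 : L.ctr 0 ≤ x.1 i) (h2 : x.1 i ≤ L.ctr 0 + L.l / 2) : x ∈ L.superlevel i H := by
  refine hB.mem_superlevel (Or.inr ⟨h1, by linarith [L.W_eq, L.l_pos]⟩) fun k hk => ?_
  linarith [far_of_le h2 hk, L.height_le_l, L.height_pos]

/-- Near the left end of `inner` the boundary is only the slice over `ctr 0`: to its left lies the
open slab over the interior of `low`, to its right the level set without cuts or holes. -/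
theorem IsBump.abs_sub_le_infDist_frontier (hB : L.IsBump i H R k) {x : UnitCube d}
    (hx : |x.1 i - L.ctr 0| ≤ L.l / 10) :
    |x.1 i - L.ctr 0| ≤ Metric.infDist x (frontier (L.superlevel i H)) := by
  refine (Metric.le_infDist hB.frontier_nonempty).2 fun z hz => ?_
  by_contra! hlt
  have h1 := (abs_coord_sub_le_dist i x z).trans_lt hlt
  have hl := L.l_pos
  have hW := L.W_eq
  have h2 : |z.1 i - L.ctr 0| ≤ |x.1 i - z.1 i| + |x.1 i - L.ctr 0| := by
    rw [abs_sub_comm (x.1 i) (z.1 i)]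
    exact abs_sub_le _ _ _
  have h3 := abs_lt.1 (show |z.1 i - L.ctr 0| < L.l / 4 by linarith)
  rcases lt_trichotomy (z.1 i) (L.ctr 0) with h | h | h
  · rw [← frontier_compl] at hz
    refine hz.2 (mem_interior.2 ⟨{y | y.1 i ∈ Set.Ioo (L.ctr 0 - L.W) (L.ctr 0)}, ?_,
      isOpen_Ioo.preimage (continuous_coord i), ⟨by linarith, h⟩⟩)
    exact fun y hy hyG => notMem_good_of_low ⟨hy.1.le, hy.2⟩ hyG.1
  · rw [h] at h1
    exact lt_irrefl _ h1
  · refine hz.2 (mem_interior.2 ⟨{y | y.1 i ∈ Set.Ioo (L.ctr 0) (L.ctr 0 + L.l / 2)}, ?_,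
      isOpen_Ioo.preimage (continuous_coord i), ⟨h, by linarith⟩⟩)
    exact fun y hy => hB.mem_superlevel_right hy.1.le hy.2.le

/-- The witness is a point of the slice over `ctr 0`. All of `K` and the bump are at distance of
order `l`, so within `l / 10` the deviation from `γ` is at most `C₁` times the `α`-th power of the
distance to that slice. -/
theorem IsBump.upperRegular (hB : L.IsBump i H R k) (hb : b ≤ L.γ / 2) {C₂ δ : ℝ}
    (hC : L.C₁ ≤ C₂) (hδ : δ ≤ L.l / 10) :
    UpperRegular L.α L.γ C₂ δ (L.density b i H R) := by
  have hl := L.l_pos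
  have hcI := mem_Icc_of_inner L.ctr_mem_inner
  let o : UnitCube d := ⟨0, fun _ => by simp⟩
  rw [UpperRegular, hB.levelSet_density hb]
  refine ⟨moveCoord i o (L.ctr 0) hcI, ?_, fun x hx => ?_⟩
  · rw [frontier_eq_closure_inter_closure]
    refine ⟨subset_closure (hB.mem_superlevel_right (by simp) (by simp; positivity)), ?_⟩
    refine Metric.mem_closure_iff.2 fun σ hσ => ?_
    have hm := lt_min hσ L.W_pos
    have hs : L.ctr 0 - min σ L.W / 2 ∈ L.low :=
      ⟨by linarith [min_le_right σ L.W], by linarith⟩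
    refine ⟨moveCoord i o _ (mem_Icc_of_low hs), fun h => notMem_good_of_low hs ?_, ?_⟩
    · simpa using h.1
    · rw [dist_moveCoord_moveCoord, sub_sub_cancel, abs_of_pos (by linarith)]
      linarith [min_le_left σ L.W]
  · have hxc : |x.1 i - L.ctr 0| ≤ L.l / 10 := by
      have := abs_coord_sub_le_dist i x (moveCoord i o (L.ctr 0) hcI)
      rw [moveCoord_apply_self] at this
      exact this.trans ((Metric.mem_closedBall.1 hx).trans hδ)
    have hfar : ∀ k ∈ L.K, L.l / 2 ≤ |x.1 i - k| := fun k hk =>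
      far_of_le (by linarith [(abs_le.1 hxc).2]) hk
    have hhl := L.height_le_l
    have hh := L.height_pos
    have hxH : x ∉ H := fun h => by
      linarith [hB.near_H x h, hfar k hB.mem_K]
    have hxR : x ∉ R := fun h => by
      linarith [(hB.near_R x h).2, hfar k hB.mem_K]
    have hmain : |L.density b i H R x - L.γ| ≤ L.C₁ * |x.1 i - L.ctr 0| ^ L.α := by
      rw [density_off hxH hxR]
      obtain h | h := le_or_gt (L.ctr 0) (x.1 i)
      · rw [base_inner ⟨h, by linarith [(abs_le.1 hxc).2, L.W_eq]⟩
          (notMem_K_of_forall (half_pos hl) hfar), add_sub_cancel_left,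
          abs_of_nonneg (mul_nonneg L.C₁_pos.le (Real.rpow_nonneg Metric.infDist_nonneg _))]
        refine mul_le_mul_of_nonneg_left (Real.rpow_le_rpow Metric.infDist_nonneg ?_ L.α_pos.le)
          L.C₁_pos.le
        exact Metric.infDist_le_dist_of_mem (Set.mem_insert _ _)
      · rw [base_low ⟨by linarith [(abs_le.1 hxc).1, L.W_eq], h⟩, sub_sub_cancel_left, abs_neg,
          abs_sub_comm (x.1 i), abs_of_pos (_root_.sub_pos.2 h),
          abs_of_nonneg (mul_nonneg L.C₁_pos.le (Real.rpow_nonneg (_root_.sub_pos.2 h).le _))]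
    refine hmain.trans (mul_le_mul hC (Real.rpow_le_rpow (abs_nonneg _)
      (hB.abs_sub_le_infDist_frontier hxc) L.α_pos.le) (Real.rpow_nonneg (abs_nonneg _) _)
      (L.C₁_pos.le.trans hC))

theorem abs_coord_sub_le_of_mem_closedBall {x : UnitCube d} {t ε : ℝ}
    {ht : t ∈ Set.Icc (0 : ℝ) 1} {z : UnitCube d}
    (hz : z ∈ Metric.closedBall (moveCoord i x t ht) ε) : |z.1 i - t| ≤ ε := by
  have := abs_coord_sub_le_dist i z (moveCoord i x t ht)
  rw [moveCoord_apply_self] at this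
  exact this.trans hz

/-- A ball in the level set near a point of the level set which is close to one of the slices over
`K`. -/
theorem IsBump.exists_ball_near_K (hB : L.IsBump i H R k) {ε C₃ : ℝ} (hε : 0 < ε)
    (hεl : ε ≤ L.l / 10) (hC₃ : L.lam ≤ C₃ / 2) {x : UnitCube d} (hx : x ∈ L.superlevel i H)
    {p : ℝ} (hp : p ∈ L.K) (hxp : |x.1 i - p| ≤ 2 * L.height) :
    ∃ t, ∃ ht : t ∈ Set.Icc (0 : ℝ) 1, |t - x.1 i| ≤ ε + C₃ * ε ∧
      Metric.closedBall (moveCoord i x t ht) ε ⊆ L.superlevel i H := by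
  have hl := L.l_pos
  have hW := L.W_eq
  have hh := L.height_pos
  have hhl := L.height_le_l
  have hhr := L.height_le
  have hr := L.r_pos
  have hrl := L.r_le_l
  have hlam := L.lam_pos
  have hlam1 := L.lam_le
  have hpK := L.K_bounds hp
  have hlε : L.lam * ε ≤ C₃ / 2 * ε := mul_le_mul_of_nonneg_right hC₃ hε.le
  have hlε1 : L.lam * ε ≤ ε := mul_le_of_le_one_left hε.le hlam1
  have hlε0 : 0 < L.lam * ε := mul_pos hlam hε
  have hxp' := abs_le.1 hxp
  -- Large scales: porosity at radius `ε + 2 * height` gives a ball clear of `K` and of the hole.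
  -- Relative to `x` the excess over `ε` is at most `lam * ε + 6 * height`, and each term is at most
  -- half of `C₃ * ε`.
  by_cases hbig : 12 * L.height ≤ C₃ * ε
  · obtain ⟨y, hy, hyK⟩ := L.porous p hp (ε + 2 * L.height) (by positivity)
    have hlh : L.lam * L.height ≤ L.height := mul_le_of_le_one_left hh.le hlam1
    have hexp : (1 + L.lam) * (ε + 2 * L.height) =
        ε + 2 * L.height + L.lam * ε + 2 * (L.lam * L.height) := by ring
    have hy' := abs_le.1 hy
    rw [hexp] at hy'
    have hin : ∀ s, |s - y| ≤ ε → s ∈ L.inner := fun s hs => by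
      rw [abs_le] at hs
      constructor <;> linarith
    refine ⟨y, mem_Icc_of_inner (hin y (by simp [hε.le])), ?_, fun z hz => ?_⟩
    · rw [abs_le]
      constructor <;> linarith
    · have hz' := abs_coord_sub_le_of_mem_closedBall hz
      refine hB.mem_superlevel (Or.inr (hin _ hz')) fun k' hk' => ?_
      have h1 := hyK k' hk'
      have h2 := abs_sub_le y (z.1 i) k'
      rw [abs_sub_comm y (z.1 i)] at h2
      linarith
  · push Not at hbig
    -- Small scales: only the slice over `p`, and possibly its hole, is within reach. The centre is
    -- moved away from `p` by `(1 + lam) * ε`, so every point of the ball is beyond `x` by at least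
    -- `lam * ε` and within `(2 + lam) * ε` of it; the cone condition then keeps the ball out of the
    -- hole.
    have hsmall : ε < L.r / 4 := by
      have h1 : L.lam * (2 * ε) < L.lam * (L.r / 2) := by
        have : 12 * L.height = L.lam * (L.r / 2) := by unfold height slope; ring
        linarith
      linarith [lt_of_mul_lt_mul_left h1 hlam.le]
    have hxK : x.1 i ∉ L.K := by
      intro h
      rcases hx.1 with h' | h'
      · exact L.notMem_outer (L.K_subset_inner h).2 h'
      · exact h'.2 h
    have hne : x.1 i ≠ p := fun h => hxK (h ▸ hp)
    have hslope : L.slope * ((2 + L.lam) * ε) ≤ L.lam * ε := by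
      have h1 : L.slope * ((2 + L.lam) * ε) = L.lam * ε * ((2 + L.lam) / 24) := by
        unfold slope; ring
      rw [h1]
      exact mul_le_of_le_one_right hlε0.le (by linarith)
    have hgood : ∀ t (ht : t ∈ Set.Icc (0 : ℝ) 1), |x.1 i - t| = (1 + L.lam) * ε →
        ∀ z ∈ Metric.closedBall (moveCoord i x t ht) ε, z.1 i ≠ p → |z.1 i - p| ≤ L.r →
        (k = p → z ∉ H) → z ∈ L.superlevel i H := by
      intro t ht hxt z hz hzp hzr hzH
      refine ⟨Or.inr ⟨L.mem_inner_of_near hp (by linarith), notMem_K_of_near hp hzr hzp⟩,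
        fun hmem => ?_⟩
      by_cases hkp : k = p
      · exact hzH hkp hmem
      · linarith [hB.near_H z hmem, le_abs_sub_of_near hp hB.mem_K hkp hzr]
    have hdist : ∀ t (ht : t ∈ Set.Icc (0 : ℝ) 1), |x.1 i - t| = (1 + L.lam) * ε →
        ∀ z ∈ Metric.closedBall (moveCoord i x t ht) ε, L.slope * dist x z ≤ L.lam * ε := by
      intro t ht hxt z hz
      refine le_trans (mul_le_mul_of_nonneg_left ?_ L.slope_pos.le) hslope
      have h1 := dist_triangle_right x z (moveCoord i x t ht)
      rw [dist_moveCoord, hxt] at h1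
      linarith [Metric.mem_closedBall.1 hz]
    rcases lt_or_gt_of_ne hne with hlt | hgt
    · have habs : |x.1 i - (x.1 i - (1 + L.lam) * ε)| = (1 + L.lam) * ε := by
        rw [sub_sub_cancel, abs_of_pos (by linarith)]
      have ht : x.1 i - (1 + L.lam) * ε ∈ Set.Icc (0 : ℝ) 1 :=
        mem_Icc_of_inner (L.mem_inner_of_near hp (by rw [abs_le]; constructor <;> linarith))
      refine ⟨_, ht, ?_, fun z hz => ?_⟩
      · rw [abs_sub_comm, habs]; linarith
      · have hz' := abs_le.1 (abs_coord_sub_le_of_mem_closedBall hz)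
        refine hgood _ ht habs z hz (by linarith) (abs_le.2 ⟨by linarith, by linarith⟩) ?_
        rintro rfl
        exact hB.down x hx.2 z hlt.le ((hdist _ ht habs z hz).trans (by linarith))
    · have habs : |x.1 i - (x.1 i + (1 + L.lam) * ε)| = (1 + L.lam) * ε := by
        rw [sub_add_cancel_left, abs_neg, abs_of_pos (by linarith)]
      have ht : x.1 i + (1 + L.lam) * ε ∈ Set.Icc (0 : ℝ) 1 :=
        mem_Icc_of_inner (L.mem_inner_of_near hp (by rw [abs_le]; constructor <;> linarith))
      refine ⟨_, ht, ?_, fun z hz => ?_⟩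
      · rw [abs_sub_comm, habs]; linarith
      · have hz' := abs_le.1 (abs_coord_sub_le_of_mem_closedBall hz)
        refine hgood _ ht habs z hz (by linarith) (abs_le.2 ⟨by linarith, by linarith⟩) ?_
        rintro rfl
        exact hB.up x hx.2 z hgt.le ((hdist _ ht habs z hz).trans (by linarith))

/-- A coordinate interval in the level set yields balls in the level set. -/
theorem exists_ball_of_forall {G : Set (UnitCube d)} {ε η t : ℝ} (hη : 0 ≤ η) (x : UnitCube d)
    (ht : t ∈ Set.Icc (0 : ℝ) 1) (htx : |t - x.1 i| ≤ ε)
    (hG : ∀ z : UnitCube d, |z.1 i - t| ≤ ε → z ∈ G) :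
    ∃ t, ∃ ht : t ∈ Set.Icc (0 : ℝ) 1, |t - x.1 i| ≤ ε + η ∧
      Metric.closedBall (moveCoord i x t ht) ε ⊆ G :=
  ⟨t, ht, by linarith, fun z hz => hG z (abs_coord_sub_le_of_mem_closedBall hz)⟩

/-- Take a point of the level set within `height` of the complement. If the complement is met at the
edge of a slab, a ball fits just inside that edge with no excess. Otherwise it is met within
`height` of some `p ∈ K`, so `x` is within `2 * height` of `p` and `exists_ball_near_K` applies. -/
theorem IsBump.levelSetRegular (hB : L.IsBump i H R k) (hb : b ≤ L.γ / 2) {C₃ ε₀ : ℝ}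
    (hC₃ : L.lam ≤ C₃ / 2) (hε₀ : ε₀ ≤ L.l / 10) :
    LevelSetRegular L.γ C₃ ε₀ (L.density b i H R) := by
  intro ε hε hεε₀
  have hεl := hεε₀.trans hε₀
  have hl := L.l_pos
  have hW := L.W_eq
  have hh := L.height_pos
  have hhl := L.height_le_l
  have hη : 0 ≤ C₃ * ε := mul_nonneg (by linarith [L.lam_pos]) hε.le
  rw [hB.levelSet_density hb]
  refine innerCover_regular_of_forall hε hη hh i hB.frontier_nonempty fun x hx w hw hxw => ?_
  have hd := abs_lt.1 ((abs_coord_sub_le_dist i x w).trans_lt hxw)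
  have habs : |x.1 i + ε - x.1 i| ≤ ε := by rw [add_sub_cancel_left, abs_of_pos hε]
  have habs' : |x.1 i - ε - x.1 i| ≤ ε := by rw [sub_sub_cancel_left, abs_neg, abs_of_pos hε]
  rcases hx.1 with ho | ⟨hin, hK⟩
  · obtain ⟨j, hj1, hjN, hj⟩ := L.mem_outer.1 ho
    have hslab : ∀ z : UnitCube d, z.1 i ∈ Set.Icc (L.ctr j - L.W) (L.ctr j + L.W) →
        z ∈ L.superlevel i H := fun z hz =>
      hB.mem_superlevel_of_outer (L.mem_outer.2 ⟨j, hj1, hjN, hz⟩)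
    have hwn : w.1 i < L.ctr j - L.W ∨ L.ctr j + L.W < w.1 i := by
      by_contra! h
      exact hw (hslab w h)
    rcases hwn with h | h
    · refine exists_ball_of_forall hη x (t := x.1 i + ε) (L.mem_Icc_of_slab hjN
        ⟨by linarith [hj.1], by linarith⟩) habs fun z hz => hslab z ?_
      rw [abs_le] at hz
      exact ⟨by linarith [hj.1], by linarith⟩
    · refine exists_ball_of_forall hη x (t := x.1 i - ε) (L.mem_Icc_of_slab hjN
        ⟨by linarith, by linarith [hj.2]⟩) habs' fun z hz => hslab z ?_
      rw [abs_le] at hz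
      exact ⟨by linarith, by linarith [hj.2]⟩
  · by_cases hwK : ∃ p ∈ L.K, |w.1 i - p| < L.height
    · obtain ⟨p, hp, hwp⟩ := hwK
      refine hB.exists_ball_near_K hε hεl hC₃ hx hp ?_
      rw [abs_lt] at hwp
      rw [abs_le]
      constructor <;> linarith
    · push Not at hwK
      have hwn : w.1 i < L.ctr 0 ∨ L.ctr 0 + L.W < w.1 i := by
        by_contra! h
        exact hw (hB.mem_superlevel (Or.inr h) hwK)
      rcases hwn with h | h
      · refine exists_ball_of_forall hη x (t := x.1 i + ε) (mem_Icc_of_inner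
          ⟨by linarith [hin.1], by linarith⟩) habs fun z hz => ?_
        rw [abs_le] at hz
        exact hB.mem_superlevel_right (by linarith [hin.1]) (by linarith)
      · refine exists_ball_of_forall hη x (t := x.1 i - ε) (mem_Icc_of_inner
          ⟨by linarith, by linarith [hin.2]⟩) habs' fun z hz => ?_
        rw [abs_le] at hz
        refine hB.mem_superlevel (Or.inr ⟨by linarith, by linarith [hin.2]⟩) fun k' hk' => ?_
        linarith [far_of_ge (t := z.1 i) (by linarith) hk']

theorem IsBump.mem_classF2 (hB : L.IsBump i H R k) (hb0 : 0 ≤ b) (hb : b ≤ L.γ / 2)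
    (hb1 : ∫ x : UnitCube d, L.base b (x.1 i) ∂(cubeVolume d) = 1) {C₂ C₃ ε₀ δ₁ δ₂ : ℝ}
    (hC₂ : L.C₁ ≤ C₂) (hC₃ : L.lam ≤ C₃ / 2) (hε₀ : ε₀ ≤ L.l / 10) (hδ₂ : δ₂ ≤ L.l / 10) :
    L.density b i H R ∈ classF2 d L.α L.γ L.F L.C₁ C₂ C₃ ε₀ δ₁ δ₂ :=
  ⟨hB.isBoundedDensity hb0 hb hb1, hB.lowerRegular hb δ₁, hB.upperRegular hb hC₂ hδ₂,
    hB.levelSetRegular hb hC₃ hε₀⟩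

end Layout

/-! ### Explicit bumps, likelihood ratios and the bound for a fixed layout. -/

namespace Layout
variable {L : Layout} {d : ℕ} {i : Fin d} {H R : Set (UnitCube d)} {k b : ℝ}

theorem IsBump.integral_density (hB : L.IsBump i H R k) (hb0 : 0 ≤ b) (hb : b ≤ L.γ / 2)
    (hb1 : ∫ x : UnitCube d, L.base b (x.1 i) ∂(cubeVolume d) = 1) :
    ∫ x, L.density b i H R x ∂(cubeVolume d) = 1 := by
  have h := (hB.isBoundedDensity hb0 hb hb1).lintegral_eq_one
  rw [integral_eq_lintegral_of_nonneg_ae (.of_forall (hB.density_nonneg hb0))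
    hB.measurable_density.aestronglyMeasurable, h, ENNReal.toReal_one]

theorem IsBump.integrable_density (hB : L.IsBump i H R k) (hb0 : 0 ≤ b) (hb : b ≤ L.γ / 2) :
    Integrable (L.density b i H R) (cubeVolume d) :=
  .of_bound hB.measurable_density.aestronglyMeasurable L.F (.of_forall fun x => by
    rw [Real.norm_of_nonneg (hB.density_nonneg hb0 x)]; exact hB.density_le hb x)

variable (L)

/-- Centre of the bump at `k`. -/
noncomputable def bumpCtr (i : Fin d) (k : ℝ) : EuclideanSpace ℝ (Fin d) :=
  WithLp.toLp 2 (Function.update (fun _ => 1 / 2) i k)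

/-- The region at `k` where the density is lowered, as a subset of Euclidean space. -/
def hole (i : Fin d) (k : ℝ) : Set (EuclideanSpace ℝ (Fin d)) :=
  {y | |y i - k| < L.slope * (L.r - dist y (bumpCtr i k))}

/-- The region at `k` where the density is raised, as a subset of Euclidean space. -/
def hill (i : Fin d) (k : ℝ) : Set (EuclideanSpace ℝ (Fin d)) :=
  (fun y => y - EuclideanSpace.single i (2 * L.height)) ⁻¹' L.hole i k

theorem isOpen_hole (i : Fin d) (k : ℝ) : IsOpen (L.hole i k) := by
  refine isOpen_lt ?_ ?_ <;> fun_prop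

theorem isOpen_hill (i : Fin d) (k : ℝ) : IsOpen (L.hill i k) :=
  (L.isOpen_hole i k).preimage (by fun_prop)

theorem slope_le_one : L.slope ≤ 1 := by unfold slope; linarith [L.lam_le]

variable {L}

theorem dist_lt_of_mem_hole {y : EuclideanSpace ℝ (Fin d)} (hy : y ∈ L.hole i k) :
    dist y (bumpCtr i k) < L.r := by
  have h : 0 < L.slope * (L.r - dist y (bumpCtr i k)) := (abs_nonneg _).trans_lt hy
  have := pos_of_mul_pos_right h L.slope_pos.le
  linarith

theorem abs_lt_of_mem_hole {y : EuclideanSpace ℝ (Fin d)} (hy : y ∈ L.hole i k) :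
    |y i - k| < L.height := by
  refine lt_of_lt_of_le hy ?_
  unfold height
  exact mul_le_mul_of_nonneg_left (by linarith [dist_nonneg (x := y) (y := bumpCtr i k)])
    L.slope_pos.le

theorem r_lt_half : L.r < 1 / 2 := by
  linarith [L.r_le_l, L.W_eq, L.two_W_lt, L.inv_N_le_one, L.l_pos]

theorem coord_mem_of_mem_hole {y : EuclideanSpace ℝ (Fin d)} (hy : y ∈ L.hole i k) {j : Fin d}
    (hj : j ≠ i) : y j ∈ Set.Icc (0 : ℝ) 1 := by
  have h1 := dist_lt_of_mem_hole hy
  rw [dist_eq_norm] at h1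
  have h2 := (PiLp.norm_apply_le (y - bumpCtr i k) j).trans_lt h1
  have h3 : (y - bumpCtr i k) j = y j - 1 / 2 := by simp [bumpCtr, hj]
  rw [h3, Real.norm_eq_abs, abs_lt] at h2
  have := L.r_lt_half
  constructor <;> linarith

theorem hole_subset_cube (hk : k ∈ L.K) :
    L.hole i k ⊆ {x : EuclideanSpace ℝ (Fin d) | ∀ j, x j ∈ Set.Icc (0 : ℝ) 1} := by
  intro y hy j
  by_cases hj : j = i
  · subst hj
    exact mem_Icc_of_inner (L.mem_inner_of_near hk
      (by linarith [abs_lt_of_mem_hole hy, L.height_le, L.r_pos, L.height_pos]))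
  · exact coord_mem_of_mem_hole hy hj

theorem hill_coord {y : EuclideanSpace ℝ (Fin d)} (hy : y ∈ L.hill i k) :
    L.height < y i - k ∧ y i - k < 3 * L.height := by
  have h := abs_lt_of_mem_hole
    (show y - EuclideanSpace.single i (2 * L.height) ∈ L.hole i k from hy)
  have h3 : (y - EuclideanSpace.single i (2 * L.height)) i = y i - 2 * L.height := by simp
  rw [h3, abs_lt] at h
  constructor <;> linarith

theorem hill_subset_cube (hk : k ∈ L.K) :
    L.hill i k ⊆ {x : EuclideanSpace ℝ (Fin d) | ∀ j, x j ∈ Set.Icc (0 : ℝ) 1} := by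
  intro y hy j
  by_cases hj : j = i
  · subst hj
    have h := hill_coord hy
    refine mem_Icc_of_inner (L.mem_inner_of_near hk (abs_le.2 ⟨?_, ?_⟩)) <;>
      linarith [L.height_le, L.r_pos, L.height_pos]
  · have h := coord_mem_of_mem_hole
      (show y - EuclideanSpace.single i (2 * L.height) ∈ L.hole i k from hy) hj
    simpa [hj] using h

theorem isBump_hole (hk : k ∈ L.K) :
    L.IsBump i (Subtype.val ⁻¹' L.hole i k) (Subtype.val ⁻¹' L.hill i k) k where
  mem_K := hk
  meas_H := measurable_subtype_coe (L.isOpen_hole i k).measurableSet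
  meas_R := measurable_subtype_coe (L.isOpen_hill i k).measurableSet
  volume_eq := by
    rw [Measure.real, Measure.real, cubeVolume_preimage (hole_subset_cube hk),
      cubeVolume_preimage (hill_subset_cube hk), hill]
    simp only [sub_eq_add_neg]
    rw [measure_preimage_add_right]
  near_H := fun x hx => abs_lt_of_mem_hole hx
  near_R := fun x hx => by
    have h := hill_coord hx
    have : 0 < x.1 i - k := L.height_pos.trans h.1
    rw [abs_of_pos this]
    exact ⟨h.1, h.2.le⟩
  -- The hole is the set where `|y i - k|` is below a function of `y` with Lipschitz constant
  -- `slope`; the cone condition is the triangle inequality for that function.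
  up := fun x hx z hxk hz hzH => by
    have h1 : L.slope * (L.r - dist x.1 (bumpCtr i k)) ≤ |x.1 i - k| := not_lt.1 hx
    have h2 : |z.1 i - k| < L.slope * (L.r - dist z.1 (bumpCtr i k)) := hzH
    have h3 := mul_le_mul_of_nonneg_left (dist_triangle x.1 z.1 (bumpCtr i k)) L.slope_pos.le
    rw [abs_of_nonneg (by linarith)] at h1
    rw [Subtype.dist_eq] at hz
    have h4 := le_abs_self (z.1 i - k)
    linarith
  down := fun x hx z hxk hz hzH => by
    have h1 : L.slope * (L.r - dist x.1 (bumpCtr i k)) ≤ |x.1 i - k| := not_lt.1 hx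
    have h2 : |z.1 i - k| < L.slope * (L.r - dist z.1 (bumpCtr i k)) := hzH
    have h3 := mul_le_mul_of_nonneg_left (dist_triangle x.1 z.1 (bumpCtr i k)) L.slope_pos.le
    rw [abs_of_nonpos (by linarith)] at h1
    rw [Subtype.dist_eq] at hz
    have h4 := neg_le_abs (z.1 i - k)
    linarith

theorem cubeVolume_hole_le (hk : k ∈ L.K) :
    (cubeVolume d).real (Subtype.val ⁻¹' L.hole i k) ≤
      L.r ^ d * (volume (Metric.ball (0 : EuclideanSpace ℝ (Fin d)) 1)).toReal := by
  have hsub : L.hole i k ⊆ Metric.ball (bumpCtr i k) L.r := fun y hy => dist_lt_of_mem_hole hy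
  rw [Measure.real, cubeVolume_preimage (hole_subset_cube hk)]
  have h := measure_mono (μ := volume) hsub
  have : Nonempty (Fin d) := ⟨i⟩
  rw [Measure.addHaar_ball _ _ L.r_pos.le, finrank_euclideanSpace_fin] at h
  have h2 := ENNReal.toReal_mono (ENNReal.mul_ne_top ENNReal.ofReal_ne_top
    Metric.isBounded_ball.measure_lt_top.ne) h
  rwa [ENNReal.toReal_mul, ENNReal.toReal_ofReal (pow_nonneg L.r_pos.le _)] at h2

/-- The centre of the bump is a limit of points of the unperturbed level set, whereas all points of
the cube within `height / 2` of it lie in the hole, because `slope ≤ 1`. -/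
theorem le_hausdorffEDist_superlevel (hk : k ∈ L.K) :
    ENNReal.ofReal (L.height / 2) ≤ Metric.hausdorffEDist (L.superlevel i ∅)
      (L.superlevel i (Subtype.val ⁻¹' L.hole i k)) := by
  have hh := L.height_pos
  have hcI : ∀ j, (bumpCtr i k) j ∈ Set.Icc (0 : ℝ) 1 := by
    intro j
    by_cases hj : j = i
    · subst hj
      simpa [bumpCtr] using mem_Icc_of_inner (L.K_subset_inner hk)
    · simp [bumpCtr, hj]; norm_num
  have hci : (bumpCtr i k) i = k := by simp [bumpCtr]
  refine ofReal_le_hausdorffEDist (c := ⟨bumpCtr i k, hcI⟩) ?_ fun y hy => ?_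
  · refine Metric.mem_closure_iff.2 fun σ hσ => ?_
    have hm := lt_min hσ L.r_pos
    have habs : |k + min σ L.r / 2 - k| = min σ L.r / 2 := by
      rw [add_sub_cancel_left, abs_of_pos (half_pos hm)]
    have hin : k + min σ L.r / 2 ∈ L.inner :=
      L.mem_inner_of_near hk (by rw [habs]; linarith [min_le_right σ L.r, L.r_pos])
    refine ⟨moveCoord i ⟨bumpCtr i k, hcI⟩ _ (mem_Icc_of_inner hin), ⟨?_, fun h => h⟩, ?_⟩
    · rw [moveCoord_apply_self]
      exact Or.inr ⟨hin, notMem_K_of_near hk (by rw [habs]; linarith [min_le_right σ L.r, L.r_pos])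
        (by linarith)⟩
    · rw [dist_moveCoord, hci, abs_sub_comm, habs]
      linarith [min_le_left σ L.r]
  · by_contra! hlt
    refine hy.2 ?_
    have h1 := (abs_coord_sub_le_dist i y ⟨bumpCtr i k, hcI⟩)
    rw [dist_comm] at hlt
    change |y.1 i - (bumpCtr i k) i| ≤ _ at h1
    rw [hci] at h1
    rw [Subtype.dist_eq] at hlt h1
    change |y.1 i - k| < L.slope * (L.r - dist y.1 (bumpCtr i k))
    have h2 : L.slope * dist y.1 (bumpCtr i k) ≤ dist y.1 (bumpCtr i k) :=
      mul_le_of_le_one_left dist_nonneg L.slope_le_one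
    have h3 : L.slope * (L.r - dist y.1 (bumpCtr i k)) =
      L.height - L.slope * dist y.1 (bumpCtr i k) := by unfold height; ring
    rw [h3]
    change dist y.1 (bumpCtr i k) < _ at hlt
    change _ ≤ dist y.1 (bumpCtr i k) at h1
    linarith

/-- The difference of the densities with and without a bump. -/
noncomputable def bumpFun (L : Layout) (i : Fin d) (k : ℝ) (x : UnitCube d) : ℝ :=
  L.ampl * ((Subtype.val ⁻¹' L.hill i k).indicator (fun _ => 1) x -
    (Subtype.val ⁻¹' L.hole i k).indicator (fun _ => 1) x)

theorem density_eq (x : UnitCube d) :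
    L.density b i (Subtype.val ⁻¹' L.hole i k) (Subtype.val ⁻¹' L.hill i k) x =
      L.base b (x.1 i) + L.bumpFun i k x := rfl

theorem density_empty (x : UnitCube d) : L.density b i ∅ ∅ x = L.base b (x.1 i) := by
  simp [density]

theorem bumpFun_eq_zero_or (hk : k ∈ L.K) (x : UnitCube d) :
    L.bumpFun i k x = 0 ∨ (L.γ / 2 ≤ L.base b (x.1 i) ∧ |x.1 i - k| ≤ L.r ∧
      |L.bumpFun i k x| = L.ampl) := by
  have hB := isBump_hole (L := L) (i := i) hk
  have hA := L.ampl_pos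
  by_cases hH : x.1 ∈ L.hole i k
  · refine Or.inr ⟨hB.base_H_ge hH, ?_, ?_⟩
    · linarith [hB.near_H x hH, L.height_le, L.height_pos]
    · have : x ∉ (Subtype.val ⁻¹' L.hill i k : Set (UnitCube d)) := hB.notMem_R_of_mem_H hH
      simp [bumpFun, hH, show x.1 ∉ L.hill i k from this, abs_of_pos hA]
  · by_cases hR : x.1 ∈ L.hill i k
    · refine Or.inr ⟨by linarith [hB.base_R_ge (b := b) hR, L.γ_pos], ?_, ?_⟩
      · linarith [(hB.near_R x hR).2, L.height_le, L.height_pos]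
      · simp [bumpFun, hH, hR, abs_of_pos hA]
    · left
      simp [bumpFun, hH, hR]

theorem abs_bumpFun_le (hk : k ∈ L.K) (x : UnitCube d) :
    |L.bumpFun i k x| ≤ L.base b (x.1 i) ∨ L.bumpFun i k x = 0 := by
  rcases bumpFun_eq_zero_or (b := b) hk x with h | ⟨h1, _, h3⟩
  · exact Or.inr h
  · left; rw [h3]; exact L.ampl_le.trans h1

/-- Likelihood ratio of the densities with and without a bump. -/
noncomputable def ratio (L : Layout) (b : ℝ) (i : Fin d) (k : ℝ) (x : UnitCube d) : ℝ :=
  1 + L.bumpFun i k x / L.base b (x.1 i)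

theorem measurable_bumpFun : Measurable (L.bumpFun i k) :=
  ((measurable_const.indicator
    (measurable_subtype_coe (L.isOpen_hill i k).measurableSet)).sub (measurable_const.indicator
      (measurable_subtype_coe (L.isOpen_hole i k).measurableSet))).const_mul _

theorem measurable_ratio : Measurable (L.ratio b i k) :=
  measurable_const.add
    (measurable_bumpFun.div ((L.measurable_base b).comp (measurable_coord i)))

theorem abs_bumpFun_div_base_le (hk : k ∈ L.K) (hb0 : 0 ≤ b) (x : UnitCube d) :
    |L.bumpFun i k x / L.base b (x.1 i)| ≤ 1 := by
  have h0 := base_nonneg (L := L) (t := x.1 i) hb0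
  rw [abs_div, abs_of_nonneg h0]
  rcases abs_bumpFun_le (b := b) (i := i) hk x with h | h
  · exact div_le_one_of_le₀ h h0
  · simp [h]

theorem base_mul_ratio (hk : k ∈ L.K) (x : UnitCube d) :
    L.base b (x.1 i) * L.ratio b i k x = L.base b (x.1 i) + L.bumpFun i k x := by
  unfold ratio
  rcases bumpFun_eq_zero_or (b := b) (i := i) hk x with h | ⟨h, _⟩
  · simp [h]
  · have : 0 < L.base b (x.1 i) := by linarith [L.γ_pos]
    field_simp

theorem bumpFun_mul_eq_zero {k' : ℝ} (hk : k ∈ L.K) (hk' : k' ∈ L.K) (hne : k ≠ k')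
    (x : UnitCube d) : L.bumpFun i k x * L.bumpFun i k' x = 0 := by
  rcases bumpFun_eq_zero_or (b := 0) (i := i) hk x with h | ⟨_, h, _⟩
  · rw [h, zero_mul]
  rcases bumpFun_eq_zero_or (b := 0) (i := i) hk' x with h' | ⟨_, h', _⟩
  · rw [h', mul_zero]
  have h1 := L.sep k hk k' hk' hne
  have h2 := abs_sub_le k (x.1 i) k'
  rw [abs_sub_comm k (x.1 i)] at h2
  linarith [L.r_pos]

/-- The quantity raised to the power `n` bounds the second moment of one likelihood ratio: the
perturbation has size `ampl`, the base is at least `γ / 2` where it is nonzero, and hole and hill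
each have at most the volume of a ball of radius `r`. -/
theorem ofReal_le_minimaxRisk_of_layout (L : Layout) (i : Fin d) {C₂ C₃ ε₀ δ₁ δ₂ : ℝ} (n : ℕ)
    (hK : L.K.Nonempty) (hC₂ : L.C₁ ≤ C₂) (hC₃ : L.lam ≤ C₃ / 2) (hε₀ : ε₀ ≤ L.l / 10)
    (hδ₂ : δ₂ ≤ L.l / 10)
    (hn : (1 + 4 * L.ampl ^ 2 / L.γ *
      (L.r ^ d * (volume (Metric.ball (0 : EuclideanSpace ℝ (Fin d)) 1)).toReal)) ^ n ≤
        (L.K.card : ℝ) / 4) :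
    ENNReal.ofReal (L.height / 8) ≤
      minimaxRisk n L.γ (classF2 d L.α L.γ L.F L.C₁ C₂ C₃ ε₀ δ₁ δ₂) := by
  obtain ⟨k₀, hk₀⟩ := hK
  obtain ⟨b, hb0, hb, hb1⟩ := L.exists_integral_base_eq_one i
  have hB₀ := L.isBump_empty i hk₀
  have hB : ∀ k : {k // k ∈ L.K}, L.IsBump i _ _ k.1 := fun k => isBump_hole k.2
  have hbase : ∀ x : UnitCube d, 0 ≤ L.base b (x.1 i) := fun x => base_nonneg hb0
  have hbase_i := L.integrable_base i hb0 hb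
  have hν : ∀ g : UnitCube d → ℝ,
      ∫ x, g x ∂((cubeVolume d).withDensity fun x => ENNReal.ofReal (L.density b i ∅ ∅ x)) =
        ∫ x, L.base b (x.1 i) * g x ∂(cubeVolume d) := by
    intro g
    rw [integral_withDensity_eq_integral_toReal_smul hB₀.measurable_density.ennreal_ofReal
      (.of_forall fun x => ENNReal.ofReal_lt_top)]
    refine integral_congr_ae (.of_forall fun x => ?_)
    simp only [smul_eq_mul, density_empty, ENNReal.toReal_ofReal (hbase x)]
  have hfi : ∀ k : {k // k ∈ L.K},
      Integrable (fun x : UnitCube d => L.base b (x.1 i) + L.bumpFun i k.1 x) (cubeVolume d) :=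
    fun k => (hB k).integrable_density hb0 hb
  have hadd : ∀ j k : {k // k ∈ L.K}, Integrable (fun x : UnitCube d =>
      (L.base b (x.1 i) + L.bumpFun i j.1 x) + (L.base b (x.1 i) + L.bumpFun i k.1 x))
      (cubeVolume d) := fun j k => (hfi j).add (hfi k)
  have hf1 : ∀ k : {k // k ∈ L.K},
      ∫ x : UnitCube d, (L.base b (x.1 i) + L.bumpFun i k.1 x) ∂(cubeVolume d) = 1 :=
    fun k => (hB k).integral_density hb0 hb hb1
  have hs : L.height / 8 = L.height / 2 / 4 := by ring
  rw [hs]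
  refine ofReal_le_minimaxRisk i (Finset.univ : Finset {k // k ∈ L.K}) ⟨⟨k₀, hk₀⟩, by simp⟩
    (hB₀.isBoundedDensity hb0 hb hb1)
    (f := fun k => L.density b i (Subtype.val ⁻¹' L.hole i k.1) (Subtype.val ⁻¹' L.hill i k.1))
    (φ := fun k => L.ratio b i k.1) (B := 2)
    (V := 4 * L.ampl ^ 2 / L.γ *
      (L.r ^ d * (volume (Metric.ball (0 : EuclideanSpace ℝ (Fin d)) 1)).toReal))
    (fun k _ => (hB k).isBoundedDensity hb0 hb hb1)
    (hB₀.mem_classF2 hb0 hb hb1 hC₂ hC₃ hε₀ hδ₂)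
    (fun k _ => (hB k).mem_classF2 hb0 hb hb1 hC₂ hC₃ hε₀ hδ₂) ?_ (fun k => measurable_ratio)
    ?_ ?_ ?_ ?_ ?_ ?_ (half_pos L.height_pos).le ?_ ?_ ?_ ?_
  · intro k _ x
    rw [density_eq, density_empty, base_mul_ratio k.2]
  · intro k x
    have := (abs_le.1 (abs_bumpFun_div_base_le (i := i) k.2 hb0 x)).1
    unfold ratio
    linarith
  · intro k x
    have := (abs_le.1 (abs_bumpFun_div_base_le (i := i) k.2 hb0 x)).2
    unfold ratio
    linarith
  · intro k _
    rw [hν]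
    exact (integral_congr_ae (.of_forall fun x => base_mul_ratio k.2 x)).trans (hf1 k)
  · intro j _ k _ hjk
    have hjk' : j.1 ≠ k.1 := fun h => hjk (Subtype.ext h)
    rw [hν]
    -- Bumps at different points have disjoint supports, so the product term vanishes and the
    -- integral is `1 + 1 - 1`.
    have hpt : ∀ x : UnitCube d, L.base b (x.1 i) * (L.ratio b i j.1 x * L.ratio b i k.1 x) =
        (L.base b (x.1 i) + L.bumpFun i j.1 x) + (L.base b (x.1 i) + L.bumpFun i k.1 x) -
          L.base b (x.1 i) := by
      intro x
      rw [← mul_assoc, base_mul_ratio j.2, ratio, mul_add, mul_one]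
      rw [add_mul, mul_div_assoc', mul_div_assoc', bumpFun_mul_eq_zero j.2 k.2 hjk' x, zero_div,
        add_zero]
      have := base_mul_ratio (b := b) (i := i) k.2 x
      rw [ratio, mul_add, mul_one, mul_div_assoc'] at this
      linarith
    rw [integral_congr_ae (.of_forall hpt), integral_sub (hadd j k) hbase_i,
      integral_add (hfi j) (hfi k), hf1, hf1, hb1]
    norm_num
  · intro k _
    rw [hν]
    set H : Set (UnitCube d) := Subtype.val ⁻¹' L.hole i k.1
    set R : Set (UnitCube d) := Subtype.val ⁻¹' L.hill i k.1
    have hHi : Integrable (H.indicator fun _ => (1 : ℝ)) (cubeVolume d) :=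
      (integrable_const _).indicator (hB k).meas_H
    have hRi : Integrable (R.indicator fun _ => (1 : ℝ)) (cubeVolume d) :=
      (integrable_const _).indicator (hB k).meas_R
    -- With `u` the bump and `f₀` the base, the left side is `f₀ + 2 * u + u ^ 2 / f₀`; the first
    -- two terms are written through the perturbed density, whose integral is known.
    have hpt : ∀ x : UnitCube d, L.base b (x.1 i) * (L.ratio b i k.1 x * L.ratio b i k.1 x) ≤
        (L.base b (x.1 i) + L.bumpFun i k.1 x) + (L.base b (x.1 i) + L.bumpFun i k.1 x) -
          L.base b (x.1 i) + 2 * L.ampl ^ 2 / L.γ *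
            (R.indicator (fun _ => 1) x + H.indicator (fun _ => 1) x) := by
      intro x
      have hγ := L.γ_pos
      have hind : ∀ S : Set (UnitCube d), 0 ≤ S.indicator (fun _ => (1 : ℝ)) x := fun S =>
        Set.indicator_nonneg (fun _ _ => zero_le_one) x
      rw [← mul_assoc, base_mul_ratio k.2]
      rcases bumpFun_eq_zero_or (b := b) (i := i) k.2 x with h | ⟨h1, _, h3⟩
      · rw [ratio, h]
        have : 0 ≤ 2 * L.ampl ^ 2 / L.γ *
            (R.indicator (fun _ => 1) x + H.indicator (fun _ => 1) x) :=
          mul_nonneg (by positivity) (add_nonneg (hind R) (hind H))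
        simp only [add_zero, zero_div, mul_one]
        linarith
      · have hpos : 0 < L.base b (x.1 i) := by linarith
        have hone : 1 ≤ R.indicator (fun _ => (1 : ℝ)) x + H.indicator (fun _ => 1) x := by
          by_cases hR : x ∈ R
          · rw [Set.indicator_of_mem hR]; linarith [hind H]
          · by_cases hH : x ∈ H
            · rw [Set.indicator_of_mem hH]; linarith [hind R]
            · have h0 : L.bumpFun i k.1 x = L.ampl * (R.indicator (fun _ => 1) x -
                H.indicator (fun _ => 1) x) := rfl
              rw [h0, Set.indicator_of_notMem hR, Set.indicator_of_notMem hH, sub_zero, mul_zero,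
                abs_zero] at h3
              linarith [L.ampl_pos]
        have hsq : L.bumpFun i k.1 x ^ 2 = L.ampl ^ 2 := by rw [← sq_abs, h3]
        have hexp : (L.base b (x.1 i) + L.bumpFun i k.1 x) * L.ratio b i k.1 x =
            L.base b (x.1 i) + 2 * L.bumpFun i k.1 x + L.ampl ^ 2 / L.base b (x.1 i) := by
          rw [← hsq]
          unfold ratio
          field_simp
          ring
        have hle : L.ampl ^ 2 / L.base b (x.1 i) ≤ 2 * L.ampl ^ 2 / L.γ := by
          rw [div_le_div_iff₀ hpos hγ]
          nlinarith [sq_nonneg L.ampl]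
        have hle2 : 2 * L.ampl ^ 2 / L.γ ≤ 2 * L.ampl ^ 2 / L.γ *
            (R.indicator (fun _ => 1) x + H.indicator (fun _ => 1) x) :=
          le_mul_of_one_le_right (by positivity) hone
        rw [hexp]
        linarith
    have hrest : Integrable (fun x => (L.base b (x.1 i) + L.bumpFun i k.1 x) +
        (L.base b (x.1 i) + L.bumpFun i k.1 x) - L.base b (x.1 i)) (cubeVolume d) :=
      (hadd k k).sub hbase_i
    have hextra : Integrable (fun x => 2 * L.ampl ^ 2 / L.γ *
        (R.indicator (fun _ => (1 : ℝ)) x + H.indicator (fun _ => 1) x)) (cubeVolume d) :=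
      (hRi.add hHi).const_mul _
    have hle := integral_mono_of_nonneg
      (.of_forall fun x => mul_nonneg (hbase x) (mul_self_nonneg (L.ratio b i k.1 x)))
      (hrest.add hextra) (.of_forall hpt)
    refine hle.trans ?_
    rw [integral_add' hrest hextra, integral_sub (hadd k k) hbase_i,
      integral_add (hfi k) (hfi k), hf1, hb1, integral_const_mul, integral_add hRi hHi,
      integral_indicator_const _ (hB k).meas_R, integral_indicator_const _ (hB k).meas_H,
      (hB k).volume_eq]
    have hvol := cubeVolume_hole_le (i := i) k.2
    have hc : 0 ≤ 4 * L.ampl ^ 2 / L.γ := by have := L.γ_pos; positivity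
    have hfin := mul_le_mul_of_nonneg_left hvol hc
    simp only [smul_eq_mul, mul_one]
    have hring : 2 * L.ampl ^ 2 / L.γ * ((cubeVolume d).real H + (cubeVolume d).real H) =
        4 * L.ampl ^ 2 / L.γ * (cubeVolume d).real H := by ring
    rw [hring]
    linarith
  · simpa using hn
  · linarith [L.height_le, L.r_lt_half, L.height_pos]
  · rw [hB₀.levelSet_density hb]
    obtain ⟨w, hw, _⟩ := hB₀.exists_mem_superlevel_near (⟨0, fun _ => by simp⟩ : UnitCube d)
    exact ⟨w, hw⟩
  · intro k _
    rw [(hB k).levelSet_density hb]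
    obtain ⟨w, hw, _⟩ := (hB k).exists_mem_superlevel_near (⟨0, fun _ => by simp⟩ : UnitCube d)
    exact ⟨w, hw⟩
  · intro k _
    rw [hB₀.levelSet_density hb, (hB k).levelSet_density hb]
    exact le_hausdorffEDist_superlevel k.2

end Layout

/-! ### Choice of the parameters and conclusion. -/

/-- Taking `q ^ m` of order `(log n / n) ^ (1 / β)` makes `n * V` at most a constant times `log n`,
and `m` itself grows like `log n`. A fixed additional depth `m₁` makes the constant small enough for
`exp (n * V) ≤ 2 ^ m / 4`, at the price of a constant factor in the rate. -/
theorem exists_depth {q β D : ℝ} (hq : 0 < q) (hq1 : q < 1) (hβ : 0 < β) :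
    ∃ c : ℝ, 0 < c ∧ ∀ᶠ n : ℕ in atTop, ∃ m : ℕ,
      c * ((n : ℝ) / Real.log n) ^ (-(1 / β)) ≤ q ^ m ∧
        (∀ V, 0 ≤ V → V ≤ D * (q ^ m) ^ β → (1 + V) ^ n ≤ (2 : ℝ) ^ m / 4) := by
  set a := -Real.log q with ha_def
  have ha : 0 < a := neg_pos.2 (Real.log_neg hq hq1)
  have hqm : ∀ m : ℕ, q ^ m = Real.exp (-(a * m)) := fun m => by
    rw [ha_def, neg_mul, neg_neg, mul_comm, Real.exp_nat_mul, Real.exp_log hq]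
  have hlog2 : 0 < Real.log 2 := Real.log_pos one_lt_two
  -- The first condition absorbs `D`; the second gives `m / 2 ≤ m - 2`, which pays for the division
  -- by `4`.
  obtain ⟨m₁, hm₁, hm₁4⟩ : ∃ m₁ : ℕ, D * Real.exp (-(a * β * m₁)) ≤ Real.log 2 / (4 * (a * β)) ∧
      4 ≤ m₁ := by
    have h1 : Tendsto (fun m : ℕ => D * Real.exp (-(a * β * m))) atTop (nhds (D * 0)) := by
      refine Tendsto.const_mul _ (Real.tendsto_exp_neg_atTop_nhds_zero.comp ?_)
      exact tendsto_natCast_atTop_atTop.const_mul_atTop (mul_pos ha hβ)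
    rw [mul_zero] at h1
    have h2 : 0 < Real.log 2 / (4 * (a * β)) := by positivity
    exact ((h1.eventually (ge_mem_nhds h2)).and (eventually_ge_atTop 4)).exists
  refine ⟨Real.exp (-(a * (m₁ + 1))), Real.exp_pos _, ?_⟩
  have hlogn : Tendsto (fun n : ℕ => Real.log n) atTop atTop :=
    Real.tendsto_log_atTop.comp tendsto_natCast_atTop_atTop
  -- This makes `log (n / log n)` at least half of `log n`, so that `m` is of order `log n`.
  have hloglog : ∀ᶠ n : ℕ in atTop, Real.log (Real.log n) ≤ 1 / 2 * Real.log n := by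
    have h := hlogn.eventually (Real.isLittleO_log_id_atTop.def (c := 1 / 2) (by norm_num))
    filter_upwards [h, hlogn.eventually_ge_atTop 1] with n hn hn1
    simp only [id, Real.norm_eq_abs] at hn
    rw [abs_of_nonneg (by linarith : (0 : ℝ) ≤ Real.log n)] at hn
    exact (le_abs_self _).trans hn
  filter_upwards [hloglog, hlogn.eventually_ge_atTop 1, eventually_gt_atTop 0] with n hn hn1 hn0
  have hnpos : (0 : ℝ) < n := by exact_mod_cast hn0
  have hlpos : 0 < Real.log n := by linarith
  set y := Real.log ((n : ℝ) / Real.log n) with hy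
  have hxpos : 0 < (n : ℝ) / Real.log n := by positivity
  have hylow : Real.log n / 2 ≤ y := by
    rw [hy, Real.log_div hnpos.ne' hlpos.ne']; linarith
  have hy0 : 0 ≤ y := by linarith
  have hexpy : Real.exp (-y) = Real.log n / n := by
    rw [hy, Real.exp_neg, Real.exp_log hxpos, inv_div]
  set t := y / (a * β) with ht
  have ht0 : 0 ≤ t := by positivity
  have hat : a * β * t = y := by rw [ht]; field_simp
  refine ⟨⌈t⌉₊ + m₁, ?_, fun V hV0 hV => ?_⟩
  · rw [hqm, Real.rpow_def_of_pos hxpos, ← Real.exp_add]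
    refine Real.exp_le_exp.2 ?_
    rw [← hy]
    push_cast
    have h1 : (⌈t⌉₊ : ℝ) ≤ t + 1 := (Nat.ceil_lt_add_one ht0).le
    have h2 : y * -(1 / β) = -(a * t) := by rw [ht]; field_simp
    rw [h2]
    have := mul_le_mul_of_nonneg_left h1 ha.le
    linarith
  · set m := ⌈t⌉₊ + m₁ with hm
    have hmt : t + m₁ ≤ m := by
      rw [hm]; push_cast; linarith [Nat.le_ceil t]
    have hm4 : (4 : ℝ) ≤ m := by
      have : (4 : ℝ) ≤ m₁ := by exact_mod_cast hm₁4
      linarith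
    have hpow : (q ^ m) ^ β ≤ Real.log n / n * Real.exp (-(a * β * m₁)) := by
      rw [hqm, ← Real.exp_mul, ← hexpy, ← Real.exp_add]
      refine Real.exp_le_exp.2 ?_
      have := mul_le_mul_of_nonneg_left hmt (mul_pos ha hβ).le
      linarith
    have hqmpos : 0 ≤ (q ^ m) ^ β := by positivity
    have hnV : n * V ≤ Real.log 2 * (m / 2) := by
      obtain hD | hD := le_or_gt D 0
      · have : V ≤ 0 := hV.trans (mul_nonpos_of_nonpos_of_nonneg hD hqmpos)
        have h1 : n * V ≤ 0 := mul_nonpos_of_nonneg_of_nonpos hnpos.le this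
        exact h1.trans (by positivity)
      · calc n * V ≤ n * (D * (Real.log n / n * Real.exp (-(a * β * m₁)))) := by
              refine mul_le_mul_of_nonneg_left (hV.trans ?_) hnpos.le
              exact mul_le_mul_of_nonneg_left hpow hD.le
          _ = D * Real.exp (-(a * β * m₁)) * Real.log n := by field_simp
          _ ≤ Real.log 2 / (4 * (a * β)) * Real.log n :=
              mul_le_mul_of_nonneg_right hm₁ hlpos.le
          _ ≤ Real.log 2 / (4 * (a * β)) * (2 * y) :=
              mul_le_mul_of_nonneg_left (by linarith) (by positivity)
          _ = Real.log 2 * (t / 2) := by rw [ht]; field_simp; ring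
          _ ≤ Real.log 2 * (m / 2) := by
              have : (0 : ℝ) ≤ m₁ := by positivity
              exact mul_le_mul_of_nonneg_left (by linarith) hlog2.le
    have h2m : (2 : ℝ) ^ m / 4 = Real.exp (Real.log 2 * (m - 2)) := by
      rw [mul_sub, Real.exp_sub, mul_comm, Real.exp_nat_mul, Real.exp_log two_pos,
        mul_comm (Real.log 2) 2, show (2 : ℝ) * Real.log 2 = ((2 : ℕ) : ℝ) * Real.log 2 by norm_num,
        Real.exp_nat_mul, Real.exp_log two_pos]
      norm_num
    calc (1 + V) ^ n ≤ Real.exp V ^ n := by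
          refine pow_le_pow_left₀ (by linarith) ?_ n
          linarith [Real.add_one_le_exp V]
      _ = Real.exp (n * V) := (Real.exp_nat_mul _ _).symm
      _ ≤ Real.exp (Real.log 2 * (m - 2)) := Real.exp_le_exp.2 (hnV.trans
          (mul_le_mul_of_nonneg_left (by linarith) hlog2.le))
      _ = (2 : ℝ) ^ m / 4 := h2m.symm

theorem exists_slab_count {α γ F C₁ : ℝ} (hα : 0 < α) (hγ : 0 < γ) (hγF : γ < F) (hF : 1 < F) :
    ∃ N : ℕ, 0 < N ∧ 3 * (C₁ * (1 / (N : ℝ)) ^ α) ≤ γ / 2 ∧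
      3 * (C₁ * (1 / (N : ℝ)) ^ α) ≤ F - γ ∧ 1 / (N : ℝ) ≤ γ / 2 * (1 - 1 / F) := by
  have h0 : Tendsto (fun N : ℕ => 1 / (N : ℝ)) atTop (nhds 0) := tendsto_one_div_atTop_nhds_zero_nat
  have h1 : Tendsto (fun N : ℕ => 3 * (C₁ * (1 / (N : ℝ)) ^ α)) atTop (nhds 0) := by
    have := ((h0.rpow_const (p := α) (Or.inr hα.le)).const_mul C₁).const_mul 3
    rwa [Real.zero_rpow hα.ne', mul_zero, mul_zero] at this
  have hF1 : 0 < 1 - 1 / F := by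
    rw [sub_pos, div_lt_one (by linarith)]; exact hF
  have h2 : 0 < γ / 2 * (1 - 1 / F) := by positivity
  obtain ⟨N, hN⟩ := ((eventually_gt_atTop 0).and ((h1.eventually (ge_mem_nhds (half_pos hγ))).and
    ((h1.eventually (ge_mem_nhds (sub_pos.2 hγF))).and (h0.eventually (ge_mem_nhds h2))))).exists
  exact ⟨N, hN.1, hN.2.1, hN.2.2.1, hN.2.2.2⟩

/-- The Cantor stage in `[0, 2]` is carried by `x ↦ s + l * x` into the first slab, away from both
its ends. Its separation `l * q ^ m` is `4 * r`. -/
theorem exists_layout {α γ F C₁ lam q : ℝ} {N : ℕ} (hα : 0 < α) (hγ : 0 < γ) (hγF : γ < F)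
    (hF : 1 < F) (hC₁ : 0 < C₁) (hN : 0 < N) (hnet : 3 * (C₁ * (1 / (N : ℝ)) ^ α) ≤ γ / 2)
    (hnet' : 3 * (C₁ * (1 / (N : ℝ)) ^ α) ≤ F - γ) (hmass : 1 / (N : ℝ) ≤ γ / 2 * (1 - 1 / F))
    (hlam : 0 < lam) (hlam1 : lam ≤ 1) (hq : 0 < q) (hq1 : q ≤ lam / 12) (m : ℕ) :
    ∃ L : Layout, L.α = α ∧ L.γ = γ ∧ L.F = F ∧ L.C₁ = C₁ ∧ L.lam = lam ∧ L.N = N ∧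
      L.r = 1 / (2 * F * N) / 8 / 4 * q ^ m ∧ L.K.card = 2 ^ m := by
  classical
  obtain ⟨E, hcard, hsub, hpor, hsep⟩ := exists_porous_finset hlam hlam1 hq hq1 m
  have hN' : (0 : ℝ) < N := by exact_mod_cast hN
  have hF0 : 0 < F := by linarith
  set l := 1 / (2 * F * N) / 8 with hl
  have hl0 : 0 < l := by positivity
  set s := 1 / (2 * (N : ℝ)) + l
  have hinj : Function.Injective fun x : ℝ => s + l * x := fun a b h => by
    simpa [hl0.ne'] using h
  refine ⟨{ α := α, γ := γ, F := F, C₁ := C₁, lam := lam, r := l / 4 * q ^ m, N := N,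
            K := E.image fun x => s + l * x, α_pos := hα, γ_pos := hγ, γ_lt := hγF, one_lt := hF,
            C₁_pos := hC₁, N_pos := hN, net := hnet, net' := hnet', mass := hmass,
            lam_pos := hlam, lam_le := hlam1, r_pos := by positivity, r_le := ?_,
            K_subset := ?_, porous := ?_, sep := ?_ }, rfl, rfl, rfl, rfl, rfl, rfl, rfl, ?_⟩
  · exact mul_le_of_le_one_right (by positivity) (pow_le_one₀ hq.le (by linarith))
  · intro k hk
    obtain ⟨x, hx, rfl⟩ := Finset.mem_image.1 hk
    have hx2 := hsub hx
    have h1 : 0 ≤ l * x := mul_nonneg hl0.le hx2.1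
    have h2 : l * x ≤ l * 2 := mul_le_mul_of_nonneg_left hx2.2 hl0.le
    simp only [s]
    constructor <;> linarith
  · rw [Finset.coe_image]
    exact hpor.affine hl0 s
  · intro k hk k' hk' hne
    obtain ⟨x, hx, rfl⟩ := Finset.mem_image.1 hk
    obtain ⟨x', hx', rfl⟩ := Finset.mem_image.1 hk'
    rw [add_sub_add_left_eq_sub, ← mul_sub, abs_mul, abs_of_pos hl0]
    calc 4 * (l / 4 * q ^ m) = l * q ^ m := by ring
      _ ≤ l * |x - x'| := mul_le_mul_of_nonneg_left
          (hsep x hx x' hx' (by rintro rfl; exact hne rfl)) hl0.le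
  · rw [Finset.card_image_of_injective _ hinj, hcard]

theorem proposition1 (d : ℕ) (hd : 1 ≤ d) (α γ fmax C₁ C₂ C₃ δ₁ : ℝ)
    (hα : 0 < α) (hγ : 0 < γ) (hγmax : γ < fmax) (hmax : 1 < fmax)
    (hC₁ : 0 < C₁) (hC₁₂ : C₁ ≤ C₂) (hC₃ : 0 < C₃) (hδ₁ : 0 < δ₁) :
    ∃ r₀ : ℝ, 0 < r₀ ∧ ∀ ε₀ δ₂ : ℝ, 0 < ε₀ → ε₀ ≤ r₀ → 0 < δ₂ → δ₂ ≤ r₀ →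
      ∃ c : ℝ, 0 < c ∧ ∀ᶠ n : ℕ in atTop,
        minimaxRisk n γ (classF2 d α γ fmax C₁ C₂ C₃ ε₀ δ₁ δ₂) ≤
            minimaxRisk n γ (classF1 d α γ fmax C₁ C₃ ε₀ δ₁) ∧
        ENNReal.ofReal (c * ((n : ℝ) / Real.log n) ^ (-(1 / ((d : ℝ) + 2 * α)))) ≤
            minimaxRisk n γ (classF2 d α γ fmax C₁ C₂ C₃ ε₀ δ₁ δ₂) := by
  obtain ⟨N, hN, hnet, hnet', hmass⟩ := exists_slab_count (C₁ := C₁) hα hγ hγmax hmax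
  have hN' : (0 : ℝ) < N := by exact_mod_cast hN
  have hF0 : 0 < fmax := by linarith
  set l := 1 / (2 * fmax * N) / 8 with hl
  have hl0 : 0 < l := by positivity
  -- Like `N` and `l`, this is fixed before `n`; only the depth `m` varies, so the threshold `l /
  -- 10` for `ε₀` and `δ₂` does not depend on `n`.
  set lam := min 1 (C₃ / 2)
  have hlam : 0 < lam := lt_min one_pos (half_pos hC₃)
  have hlam1 : lam ≤ 1 := min_le_left _ _
  have hq : 0 < lam / 12 := by positivity
  set β := (d : ℝ) + 2 * α with hβ_def
  have hβ : 0 < β := by positivity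
  set v := (volume (Metric.ball (0 : EuclideanSpace ℝ (Fin d)) 1)).toReal
  have hv : 0 ≤ v := ENNReal.toReal_nonneg
  -- `D` collects the constants of `4 * ampl ^ 2 / γ * (r ^ d * v)` with `ampl = 2 * (C₁ * r ^ α)`
  -- and `r = l / 4 * q ^ m`.
  obtain ⟨c, hc, hev⟩ := exists_depth (D := 16 * C₁ ^ 2 / γ * v * (l / 4) ^ β) hq
    (by linarith) hβ
  refine ⟨l / 10, by positivity, fun ε₀ δ₂ _ hε₀ _ hδ₂ => ?_⟩
  refine ⟨lam / 24 * (l / 4) / 8 * c, by positivity, ?_⟩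
  filter_upwards [hev] with n ⟨m, hm1, hm2⟩
  refine ⟨minimaxRisk_anti fun f hf => ⟨hf.1, hf.2.1, hf.2.2.2⟩, ?_⟩
  obtain ⟨L, rfl, rfl, rfl, rfl, hLlam, rfl, hLr, hLK⟩ := exists_layout hα hγ hγmax hmax hC₁ hN hnet
    hnet' hmass hlam hlam1 hq le_rfl m
  have hr : L.r = l / 4 * (lam / 12) ^ m := hLr
  have hLl : L.l = l := rfl
  refine le_trans (ENNReal.ofReal_le_ofReal ?_) (L.ofReal_le_minimaxRisk_of_layout ⟨0, hd⟩ n ?_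
    hC₁₂ (hLlam.trans_le (min_le_right _ _)) (hε₀.trans_eq (by rw [hLl]))
    (hδ₂.trans_eq (by rw [hLl])) ?_)
  · have hh : L.height / 8 = lam / 24 * (l / 4) / 8 * (lam / 12) ^ m := by
      unfold Layout.height Layout.slope
      rw [hLlam, hr]
      ring
    rw [hh, mul_assoc]
    exact mul_le_mul_of_nonneg_left hm1 (by positivity)
  · exact Finset.card_pos.1 (by rw [hLK]; positivity)
  · rw [hLK]
    push_cast
    have hrpos := L.r_pos
    refine hm2 _ (by positivity) (le_of_eq ?_)
    have hrβ : (l / 4) ^ β * ((lam / 12) ^ m) ^ β = (L.r ^ L.α) ^ 2 * L.r ^ d := by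
      rw [← Real.mul_rpow (by positivity) (by positivity), ← hr, hβ_def,
        Real.rpow_add L.r_pos, Real.rpow_natCast, mul_comm 2 L.α, Real.rpow_mul L.r_pos.le,
        Real.rpow_two]
      ring
    rw [mul_assoc, hrβ]
    unfold Layout.ampl
    ring
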